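/- Let $S$ be a Clifford semigroup, that is, a semigroup in which every $s$ has a unique inverse $s^*$ (an element with $ss^*s=s$ and $s^*ss^*=s^*$) and $ss^*=s^*s$ for all $s\in S$. Let $E(S)$ be its set of idempotents, with the order $f\le e \iff f=ff^*e$ (equivalently $f=fe$), and for $e\in E(S)$ let $G_e=\{s\in S: ss^*=s^*s=e\}$ be the maximal subgroup at $e$. Assume that $E(S)$ is uniformly locally finite: $\sup_{e\in E(S)}|\{f\in E(S): f\le e\}|<\infty$. For a complex Banach algebra $A$, let $\Delta(A)$ be the set of its non-zero multiplicative linear functionals, $A\otimes_p A$ the projective tensor product with the actions $a\cdot(b\otimes c)=ab\otimes c$ and $(b\otimes c)\cdot a=b\otimes ca$ (extended canonically to $(A\otimes_pA)^{**}$), and $\pi_A:A\otimes_pA\to A$, $\pi_A(a\otimes b)=ab$. The second dual $A^{**}$ is a Banach algebra under the first Arens product, and each $\phi\in\Delta(A)$ extends to $\tilde\phi\in\Delta(A^{**})$ by $\tilde\phi(F)=F(\phi)$. The algebra $A$ is left $\phi$-biflat if there is a bounded linear map $\rho:A\to(A\otimes_pA)^{**}$ with $\rho(ab)=\phi(b)\rho(a)=a\cdot\rho(b)$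 and $\tilde\phi(\pi_A^{**}(\rho(a)))=\phi(a)$ for all $a,b\in A$; it is biflat if there is a bounded $A$-bimodule morphism $\rho:A\to(A\otimes_pA)^{**}$ such that $\pi_A^{**}(\rho(a))=a$ in $A^{**}$ for all $a\in A$. Let $\ell^1(S)$ be the Banach algebra of absolutely summable complex functions on $S$ under convolution. Then the following are equivalent: (i) $\ell^1(S)^{**}$ is left $\tilde\phi$-biflat for every $\phi\in\Delta(\ell^1(S))$; (ii) $\ell^1(S)$ is left $\phi$-biflat for every $\phi\in\Delta(\ell^1(S))$; (iii) for every $e\in E(S)$, the discrete group $G_e$ is amenable; (iv) $\ell^1(S)$ is biflat. -/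

import Mathlib

open scoped TensorProduct ENNReal

set_option linter.unusedSectionVars false

noncomputable section

namespace PhiBiflat

/-! ### Second duals of normed spaces and Banach algebras -/

section Bidual

variable {E F : Type*} [NormedAddCommGroup E] [NormedSpace ℂ E]
  [NormedAddCommGroup F] [NormedSpace ℂ F]

/-- The adjoint `T* : F* → E*`, `T* f = f ∘ T`, of a bounded operator `T : E → F`. -/
def dualMap (T : E →L[ℂ] F) : StrongDual ℂ F →L[ℂ] StrongDual ℂ E :=
  (ContinuousLinearMap.compL ℂ E F ℂ).flip T

@[simp] theorem dualMap_apply (T : E →L[ℂ] F) (f : StrongDual ℂ F) (x : E) :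
    dualMap T f x = f (T x) := rfl

/-- The Banach space `E** = (E*)*`. A type synonym, so that on a Banach algebra it can carry the
Arens product. -/
def Bidual (E : Type*) [NormedAddCommGroup E] [NormedSpace ℂ E] : Type _ :=
  StrongDual ℂ (StrongDual ℂ E)

namespace Bidual

instance : NormedAddCommGroup (Bidual E) :=
  inferInstanceAs (NormedAddCommGroup (StrongDual ℂ (StrongDual ℂ E)))

instance : NormedSpace ℂ (Bidual E) :=
  inferInstanceAs (NormedSpace ℂ (StrongDual ℂ (StrongDual ℂ E)))

instance : CompleteSpace (Bidual E) :=
  inferInstanceAs (CompleteSpace (StrongDual ℂ (StrongDual ℂ E)))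

/-- An element of the second dual, seen as a bounded functional on the dual. -/
def toDual : Bidual E ≃ₗᵢ[ℂ] StrongDual ℂ (StrongDual ℂ E) :=
  LinearIsometryEquiv.refl ℂ (StrongDual ℂ (StrongDual ℂ E))

instance : CoeFun (Bidual E) (fun _ => StrongDual ℂ E → ℂ) := ⟨fun m => ⇑(toDual m)⟩

theorem ext {m n : Bidual E} (h : ∀ f : StrongDual ℂ E, m f = n f) : m = n :=
  ContinuousLinearMap.ext h

@[simp] theorem add_apply (m n : Bidual E) (f : StrongDual ℂ E) : (m + n) f = m f + n f := rfl
@[simp] theorem zero_apply (f : StrongDual ℂ E) : (0 : Bidual E) f = 0 := rfl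
@[simp] theorem smul_apply (c : ℂ) (m : Bidual E) (f : StrongDual ℂ E) :
    (c • m) f = c * m f := rfl

/-- The canonical embedding `E → E**`. -/
def incl (E : Type*) [NormedAddCommGroup E] [NormedSpace ℂ E] : E →L[ℂ] Bidual E :=
  NormedSpace.inclusionInDoubleDual ℂ E

@[simp] theorem incl_apply (x : E) (f : StrongDual ℂ E) : incl E x f = f x := rfl

/-- The second adjoint `T** : E** → F**`. -/
def map (T : E →L[ℂ] F) : Bidual E →L[ℂ] Bidual F :=
  dualMap (dualMap T)

@[simp] theorem map_apply (T : E →L[ℂ] F) (m : Bidual E) (f : StrongDual ℂ F) :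
    map T m f = m (dualMap T f) := rfl

end Bidual

end Bidual

section Arens

variable {A : Type*} [NonUnitalNormedRing A] [NormedSpace ℂ A] [IsScalarTower ℂ A A]
  [SMulCommClass ℂ A A]

/-- The right action of `A` on `A*`: `(f · a)(b) = f (a b)`, as a bounded map in `a`. -/
def dualRight (f : StrongDual ℂ A) : A →L[ℂ] StrongDual ℂ A :=
  (ContinuousLinearMap.compL ℂ A A ℂ f).comp (ContinuousLinearMap.mul ℂ A)

@[simp] theorem dualRight_apply (f : StrongDual ℂ A) (a b : A) : dualRight f a b = f (a * b) := rfl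

namespace Bidual

/-- The left action of `A**` on `A*`: `(n · f)(a) = n (f · a)`. -/
def arensAct (n : Bidual A) (f : StrongDual ℂ A) : StrongDual ℂ A :=
  (toDual n).comp (dualRight f)

@[simp] theorem arensAct_apply (n : Bidual A) (f : StrongDual ℂ A) (a : A) :
    arensAct n f a = n (dualRight f a) := rfl

theorem norm_arensAct_le (n : Bidual A) (f : StrongDual ℂ A) :
    ‖arensAct n f‖ ≤ ‖n‖ * ‖f‖ := by
  refine ContinuousLinearMap.opNorm_le_bound _ (by positivity) fun a => ?_
  have h1 : ‖dualRight f a‖ ≤ ‖f‖ * ‖a‖ := by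
    refine ContinuousLinearMap.opNorm_le_bound _ (by positivity) fun b => ?_
    calc ‖f (a * b)‖ ≤ ‖f‖ * ‖a * b‖ := f.le_opNorm _
      _ ≤ ‖f‖ * (‖a‖ * ‖b‖) := by gcongr; exact norm_mul_le a b
      _ = _ := by ring
  calc ‖toDual n (dualRight f a)‖ ≤ ‖toDual n‖ * ‖dualRight f a‖ := (toDual n).le_opNorm _
    _ ≤ ‖n‖ * (‖f‖ * ‖a‖) := by gcongr; exact le_of_eq (toDual.norm_map n)
    _ = _ := by ring

theorem arensAct_add (n : Bidual A) (f g : StrongDual ℂ A) :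
    arensAct n (f + g) = arensAct n f + arensAct n g := by
  ext a
  exact map_add (toDual n) (dualRight f a) (dualRight g a)

theorem arensAct_smul (n : Bidual A) (c : ℂ) (f : StrongDual ℂ A) :
    arensAct n (c • f) = c • arensAct n f := by
  ext a
  exact map_smul (toDual n) c (dualRight f a)

theorem norm_arens_le (m n : Bidual A) (f : StrongDual ℂ A) :
    ‖m (arensAct n f)‖ ≤ ‖m‖ * ‖n‖ * ‖f‖ :=
  calc ‖toDual m (arensAct n f)‖ ≤ ‖toDual m‖ * ‖arensAct n f‖ := (toDual m).le_opNorm _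
    _ ≤ ‖m‖ * (‖n‖ * ‖f‖) := by
      gcongr
      · exact le_of_eq (toDual.norm_map m)
      · exact norm_arensAct_le n f
    _ = _ := by ring

/-- The functional `f ↦ m (n · f)` on `A*`. -/
def arensFun (m n : Bidual A) : StrongDual ℂ A →ₗ[ℂ] ℂ where
  toFun f := m (arensAct n f)
  map_add' f g := by rw [arensAct_add, map_add]
  map_smul' c f := by rw [arensAct_smul, map_smul, RingHom.id_apply]

/-- The first Arens product on `A**`: `(m □ n)(f) = m (n · f)`. -/
def arens (m n : Bidual A) : Bidual A :=
  (arensFun m n).mkContinuous (‖m‖ * ‖n‖) (norm_arens_le m n)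

instance : Mul (Bidual A) := ⟨arens⟩

@[simp] theorem mul_apply (m n : Bidual A) (f : StrongDual ℂ A) :
    (m * n) f = m (arensAct n f) := rfl

theorem arensAct_dualRight (n : Bidual A) (f : StrongDual ℂ A) (a : A) :
    arensAct n (dualRight f a) = dualRight (arensAct n f) a := by
  ext b
  have h : dualRight (dualRight f a) b = dualRight f (a * b) := by
    ext c
    simp only [dualRight_apply, mul_assoc]
  rw [arensAct_apply, h]; rfl

theorem arensAct_mul (m n : Bidual A) (f : StrongDual ℂ A) :
    arensAct (m * n) f = arensAct m (arensAct n f) := by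
  ext a
  simp only [arensAct_apply, mul_apply, arensAct_dualRight]

/-- The second dual of a Banach algebra, with the first Arens product, is a Banach algebra. -/
instance : NonUnitalNormedRing (Bidual A) where
  __ := (inferInstance : NormedAddCommGroup (Bidual A))
  __ := (inferInstance : Mul (Bidual A))
  left_distrib m n k := by
    refine ext fun f => ?_
    simp only [mul_apply, add_apply]
    rw [← map_add]; rfl
  right_distrib m n k := ext fun f => rfl
  zero_mul m := ext fun f => rfl
  mul_zero m := ext fun f => by
    simp only [mul_apply, zero_apply]
    exact map_zero (toDual m)
  mul_assoc m n k := ext fun f => by simp only [mul_apply, arensAct_mul]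
  norm_mul_le m n := LinearMap.mkContinuous_norm_le _ (by positivity) (norm_arens_le m n)

instance : IsScalarTower ℂ (Bidual A) (Bidual A) := ⟨fun _ _ _ => ext fun _ => rfl⟩

instance : SMulCommClass ℂ (Bidual A) (Bidual A) := ⟨fun c m n => ext fun f => by
  simp only [smul_eq_mul, smul_apply, mul_apply]
  rw [← smul_eq_mul, ← map_smul]; rfl⟩

/-- The canonical embedding of `A` into `(A**, □)` is multiplicative. -/
theorem incl_mul (a b : A) : incl A (a * b) = incl A a * incl A b := ext fun _ => rfl

end Bidual

/-- The extension `φ̃(m) = m(φ)` of a character `φ` of `A` to a character of `A**`. -/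
def bidualCharacter (φ : WeakDual.characterSpace ℂ A) :
    WeakDual.characterSpace ℂ (Bidual A) :=
  ⟨StrongDual.toWeakDual
      (NormedSpace.inclusionInDoubleDual ℂ (StrongDual ℂ A) (WeakDual.toStrongDual φ.1)), by
    constructor
    · intro h
      apply φ.2.1
      refine DFunLike.ext _ _ fun a => ?_
      exact DFunLike.congr_fun h (Bidual.incl A a)
    · intro m n
      change m (Bidual.arensAct n (WeakDual.toStrongDual φ.1)) =
        m (WeakDual.toStrongDual φ.1) * n (WeakDual.toStrongDual φ.1)
      have h : Bidual.arensAct n (WeakDual.toStrongDual φ.1) =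
          n (WeakDual.toStrongDual φ.1) • WeakDual.toStrongDual φ.1 := by
        ext a
        have h2 : dualRight (WeakDual.toStrongDual φ.1) a =
            (φ.1 a) • WeakDual.toStrongDual φ.1 := by
          ext b
          exact φ.2.2 a b
        rw [Bidual.arensAct_apply, h2, map_smul]
        simp only [smul_eq_mul, _root_.smul_apply]
        exact mul_comm _ _
      rw [h, map_smul, smul_eq_mul, mul_comm]⟩

@[simp] theorem bidualCharacter_apply (φ : WeakDual.characterSpace ℂ A) (m : Bidual A) :
    bidualCharacter φ m = m (WeakDual.toStrongDual φ.1) := rfl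

end Arens

/-! ### The projective tensor product -/

section ProjTensor

/-- The algebraic tensor product `E ⊗ F`, to be equipped with the projective norm. -/
def AlgTensor (E F : Type*) [NormedAddCommGroup E] [NormedSpace ℂ E]
    [NormedAddCommGroup F] [NormedSpace ℂ F] : Type _ := E ⊗[ℂ] F

variable {E F G : Type*} [NormedAddCommGroup E] [NormedSpace ℂ E]
  [NormedAddCommGroup F] [NormedSpace ℂ F] [NormedAddCommGroup G] [NormedSpace ℂ G]

namespace AlgTensor

instance : AddCommGroup (AlgTensor E F) := inferInstanceAs (AddCommGroup (E ⊗[ℂ] F))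
instance : Module ℂ (AlgTensor E F) := inferInstanceAs (Module ℂ (E ⊗[ℂ] F))

/-- The elementary tensors `x ⊗ y`. -/
def mk (x : E) (y : F) : AlgTensor E F := x ⊗ₜ[ℂ] y

/-- The representations `u = ∑ xᵢ ⊗ yᵢ` of `u` as a finite sum of elementary tensors. -/
abbrev Rep (u : AlgTensor E F) : Type _ :=
  {r : Multiset (E × F) // (r.map fun p => mk p.1 p.2).sum = u}

/-- The cost `∑ ‖xᵢ‖ ‖yᵢ‖` of a representation. -/
def cost (r : Multiset (E × F)) : ℝ := (r.map fun p => ‖p.1‖ * ‖p.2‖).sum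

theorem cost_nonneg (r : Multiset (E × F)) : 0 ≤ cost r := by
  refine Multiset.sum_nonneg fun x hx => ?_
  obtain ⟨p, -, rfl⟩ := Multiset.mem_map.1 hx
  positivity

/-- The projective norm `‖u‖ = inf {∑ ‖xᵢ‖ ‖yᵢ‖ : u = ∑ xᵢ ⊗ yᵢ}`. -/
def projNorm (u : AlgTensor E F) : ℝ := ⨅ r : Rep u, cost r.1

instance (u : AlgTensor E F) : Nonempty (Rep u) := by
  obtain ⟨s, hs⟩ := TensorProduct.exists_multiset (R := ℂ) (M := E) (N := F) u
  exact ⟨⟨s, hs.symm⟩⟩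

theorem projNorm_le_cost {u : AlgTensor E F} (r : Rep u) : projNorm u ≤ cost r.1 :=
  ciInf_le ⟨0, by rintro _ ⟨r, rfl⟩; exact cost_nonneg _⟩ r

theorem projNorm_smul_le (c : ℂ) (u : AlgTensor E F) : projNorm (c • u) ≤ ‖c‖ * projNorm u := by
  change _ ≤ ‖c‖ * ⨅ r : Rep u, cost r.1
  rw [Real.mul_iInf_of_nonneg (norm_nonneg c)]
  refine le_ciInf fun r => ?_
  have h : ((r.1.map fun p : E × F => (c • p.1, p.2)).map fun p => mk p.1 p.2).sum = c • u := by
    refine Eq.trans ?_ (congrArg (c • ·) r.2)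
    simp only [Multiset.smul_sum, Multiset.map_map]
    rfl
  refine (projNorm_le_cost ⟨_, h⟩).trans (le_of_eq ?_)
  simp only [cost, Multiset.map_map, Function.comp_def, norm_smul, mul_assoc,
    Multiset.sum_map_mul_left]

/-- The projective norm as a seminorm. -/
def projSeminorm : Seminorm ℂ (AlgTensor E F) :=
  Seminorm.ofSMulLE projNorm
    (le_antisymm (by simpa [cost] using projNorm_le_cost (⟨0, by simp⟩ : Rep (0 : AlgTensor E F)))
      (le_ciInf fun r => cost_nonneg _))
    (fun u v => le_ciInf_add_ciInf fun r s => by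
      have h : ((r.1 + s.1).map fun p => mk p.1 p.2).sum = u + v := by
        rw [Multiset.map_add, Multiset.sum_add, r.2, s.2]
      refine (projNorm_le_cost ⟨_, h⟩).trans (le_of_eq ?_)
      simp [cost])
    projNorm_smul_le

instance : SeminormedAddCommGroup (AlgTensor E F) :=
  AddGroupSeminorm.toSeminormedAddCommGroup projSeminorm.toAddGroupSeminorm

instance : NormedSpace ℂ (AlgTensor E F) := ⟨projNorm_smul_le⟩

theorem norm_def (u : AlgTensor E F) : ‖u‖ = ⨅ r : Rep u, cost r.1 := rfl

theorem norm_mk_le (x : E) (y : F) : ‖mk x y‖ ≤ ‖x‖ * ‖y‖ := by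
  change projNorm _ ≤ _
  simpa [cost] using projNorm_le_cost (⟨{(x, y)}, by simp⟩ : Rep (mk x y))

/-- The linear map on `E ⊗ F` induced by a bounded bilinear map. -/
def lift (B : E →L[ℂ] F →L[ℂ] G) : AlgTensor E F →L[ℂ] G :=
  LinearMap.mkContinuous (TensorProduct.lift B.toLinearMap₁₂ : E ⊗[ℂ] F →ₗ[ℂ] G) ‖B‖ (by
    intro u
    rw [norm_def, Real.mul_iInf_of_nonneg (norm_nonneg B)]
    refine le_ciInf fun r => ?_
    obtain ⟨r, rfl⟩ := r
    have h1 : (TensorProduct.lift B.toLinearMap₁₂ : E ⊗[ℂ] F →ₗ[ℂ] G)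
        (r.map fun p => mk p.1 p.2).sum = (r.map fun p => B p.1 p.2).sum := by
      refine (map_multiset_sum (TensorProduct.lift B.toLinearMap₁₂ : E ⊗[ℂ] F →ₗ[ℂ] G)
        (r.map fun p => p.1 ⊗ₜ[ℂ] p.2)).trans ?_
      rw [Multiset.map_map]; rfl
    refine (congrArg norm h1).le.trans ?_
    refine (norm_multiset_sum_le _).trans ?_
    rw [cost, ← Multiset.sum_map_mul_left, Multiset.map_map]
    refine Multiset.sum_map_le_sum_map _ _ fun p _ => ?_
    simpa [mul_assoc] using B.le_opNorm₂ p.1 p.2)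

@[simp] theorem lift_mk (B : E →L[ℂ] F →L[ℂ] G) (x : E) (y : F) : lift B (mk x y) = B x y := rfl

end AlgTensor

/-- The projective tensor product `E ⊗_p F`: the completion of `E ⊗ F` in the projective norm. -/
abbrev ProjTensor (E F : Type*) [NormedAddCommGroup E] [NormedSpace ℂ E]
    [NormedAddCommGroup F] [NormedSpace ℂ F] : Type _ :=
  UniformSpace.Completion (AlgTensor E F)

namespace ProjTensor

/-- The bounded bilinear map `(x, y) ↦ x ⊗ y` from `E × F` to `E ⊗_p F`. -/
def tmul : E →L[ℂ] F →L[ℂ] ProjTensor E F :=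
  LinearMap.mkContinuous₂
    (LinearMap.mk₂ ℂ (fun (x : E) (y : F) => (AlgTensor.mk x y : ProjTensor E F))
      (fun x x' y => by
        rw [← UniformSpace.Completion.coe_add]; congr 1; exact TensorProduct.add_tmul x x' y)
      (fun c x y => by
        rw [← UniformSpace.Completion.coe_smul]; congr 1)
      (fun x y y' => by
        rw [← UniformSpace.Completion.coe_add]; congr 1; exact TensorProduct.tmul_add x y y')
      (fun c x y => by
        rw [← UniformSpace.Completion.coe_smul]; congr 1; exact TensorProduct.tmul_smul c x y))
    1 (fun x y => by
      rw [one_mul]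
      exact (UniformSpace.Completion.norm_coe _).le.trans (AlgTensor.norm_mk_le x y))

/-- The bounded linear map on `E ⊗_p F` with `x ⊗ y ↦ B x y`, for a bounded bilinear map `B` into
a Banach space. -/
def lift [CompleteSpace G] (B : E →L[ℂ] F →L[ℂ] G) : ProjTensor E F →L[ℂ] G :=
  (AlgTensor.lift B).fromCompletion

@[simp] theorem lift_tmul [CompleteSpace G] (B : E →L[ℂ] F →L[ℂ] G) (x : E) (y : F) :
    lift B (tmul x y) = B x y := by
  change (AlgTensor.lift B).fromCompletion (AlgTensor.mk x y : ProjTensor E F) = _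
  simp

end ProjTensor

end ProjTensor

/-! ### Biflatness and left `φ`-biflatness -/

section Biflat

variable (A : Type*) [NonUnitalNormedRing A] [NormedSpace ℂ A] [IsScalarTower ℂ A A]
  [SMulCommClass ℂ A A]

/-- The product morphism `π : A ⊗_p A → A`, `π (a ⊗ b) = a b`. -/
def prodMap [CompleteSpace A] : ProjTensor A A →L[ℂ] A :=
  ProjTensor.lift (ContinuousLinearMap.mul ℂ A)

variable {A}

/-- The left action of `a` on `A ⊗_p A`: `a · (b ⊗ c) = (a b) ⊗ c`. -/
def leftAct (a : A) : ProjTensor A A →L[ℂ] ProjTensor A A :=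
  ProjTensor.lift (ProjTensor.tmul.comp (ContinuousLinearMap.mul ℂ A a))

/-- The right action of `a` on `A ⊗_p A`: `(b ⊗ c) · a = b ⊗ (c a)`. -/
def rightAct (a : A) : ProjTensor A A →L[ℂ] ProjTensor A A :=
  ProjTensor.lift
    (ProjTensor.tmul.flip.comp ((ContinuousLinearMap.mul ℂ A).flip a)).flip

@[simp] theorem prodMap_tmul [CompleteSpace A] (a b : A) :
    prodMap A (ProjTensor.tmul a b) = a * b := by simp [prodMap]

@[simp] theorem leftAct_tmul (a b c : A) :
    leftAct a (ProjTensor.tmul b c) = ProjTensor.tmul (a * b) c := by simp [leftAct]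

@[simp] theorem rightAct_tmul (a b c : A) :
    rightAct a (ProjTensor.tmul b c) = ProjTensor.tmul b (c * a) := by simp [rightAct]

/-- The left action of `a` on `(A ⊗_p A)**`. For `f` in the dual, `f · a = f ∘ (a · _)`, and
`(a · M)(f) = M (f · a)`; hence the action is the second adjoint of the left action. -/
def bidualLeftAct (a : A) : Bidual (ProjTensor A A) →L[ℂ] Bidual (ProjTensor A A) :=
  Bidual.map (leftAct a)

/-- The right action of `a` on `(A ⊗_p A)**`: `(M · a)(f) = M (a · f)` with
`a · f = f ∘ (_ · a)`. -/
def bidualRightAct (a : A) : Bidual (ProjTensor A A) →L[ℂ] Bidual (ProjTensor A A) :=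
  Bidual.map (rightAct a)

variable (A)

/-- `A` is biflat: there is a bounded `A`-bimodule morphism `ρ : A → (A ⊗_p A)**` with
`π** ∘ ρ` the canonical embedding of `A` into `A**`. -/
def IsBiflat [CompleteSpace A] : Prop :=
  ∃ ρ : A →L[ℂ] Bidual (ProjTensor A A),
    (∀ a b : A, ρ (a * b) = bidualLeftAct a (ρ b)) ∧
    (∀ a b : A, ρ (a * b) = bidualRightAct b (ρ a)) ∧
    ∀ a : A, Bidual.map (prodMap A) (ρ a) = Bidual.incl A a

/-- `A` is left `φ`-biflat: there is a bounded linear map `ρ : A → (A ⊗_p A)**` with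
`ρ (a b) = φ(b) ρ(a) = a · ρ(b)` and `φ̃ ∘ π** ∘ ρ = φ`. -/
def IsLeftBiflat [CompleteSpace A] (φ : WeakDual.characterSpace ℂ A) : Prop :=
  ∃ ρ : A →L[ℂ] Bidual (ProjTensor A A),
    (∀ a b : A, ρ (a * b) = φ b • ρ a) ∧
    (∀ a b : A, ρ (a * b) = bidualLeftAct a (ρ b)) ∧
    ∀ a : A, bidualCharacter φ (Bidual.map (prodMap A) (ρ a)) = φ a

end Biflat

/-! ### The semigroup algebra `ℓ¹(S)` -/

section EllOne

/-- The Banach space `ℓ¹(S)` of a discrete set `S`. A type synonym, so that it can carry the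
convolution product. -/
def EllOne (S : Type*) : Type _ := lp (fun _ : S => ℂ) 1

namespace EllOne

variable {S : Type*}

instance : NormedAddCommGroup (EllOne S) :=
  inferInstanceAs (NormedAddCommGroup (lp (fun _ : S => ℂ) 1))

instance : NormedSpace ℂ (EllOne S) := inferInstanceAs (NormedSpace ℂ (lp (fun _ : S => ℂ) 1))

instance : CompleteSpace (EllOne S) := inferInstanceAs (CompleteSpace (lp (fun _ : S => ℂ) 1))

instance : CoeFun (EllOne S) (fun _ => S → ℂ) := ⟨Subtype.val⟩

theorem ext {f g : EllOne S} (h : ∀ s, f s = g s) : f = g := Subtype.ext (funext h)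

@[simp] theorem add_apply (f g : EllOne S) (s : S) : (f + g) s = f s + g s := rfl
@[simp] theorem smul_apply (c : ℂ) (f : EllOne S) (s : S) : (c • f) s = c * f s := rfl

theorem hasSum_norm (f : EllOne S) : HasSum (fun s => ‖f s‖) ‖f‖ := by
  have h := lp.hasSum_norm (p := 1) (by simp) (show lp (fun _ : S => ℂ) 1 from f)
  simp only [ENNReal.toReal_one, Real.rpow_one] at h
  exact h

theorem summable_norm (f : EllOne S) : Summable fun s => ‖f s‖ := f.hasSum_norm.summable

theorem hasSum_norm_prod (f g : EllOne S) :
    HasSum (fun p : S × S => ‖f p.1 * g p.2‖) (‖f‖ * ‖g‖) := by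
  simp_rw [norm_mul]
  refine f.hasSum_norm.mul g.hasSum_norm ?_
  exact f.summable_norm.mul_of_nonneg g.summable_norm (fun _ => norm_nonneg _)
    (fun _ => norm_nonneg _)

variable [Semigroup S]

/-- The pairs `(x, y)` with `x y = s`. -/
abbrev Fiber (s : S) : Type _ := {p : S × S // p.1 * p.2 = s}

theorem hasSum_norm_sigma (f g : EllOne S) :
    HasSum (fun q : Σ s : S, Fiber s => ‖f q.2.1.1 * g q.2.1.2‖) (‖f‖ * ‖g‖) :=
  (Equiv.sigmaFiberEquiv (fun p : S × S => p.1 * p.2)).hasSum_iff.2 (hasSum_norm_prod f g)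

theorem summable_fiber (f g : EllOne S) (s : S) :
    Summable fun p : Fiber s => ‖f p.1.1 * g p.1.2‖ :=
  (hasSum_norm_prod f g).summable.subtype {p : S × S | p.1 * p.2 = s}

theorem hasSum_tsum_fiber (f g : EllOne S) :
    HasSum (fun s : S => ∑' p : Fiber s, ‖f p.1.1 * g p.1.2‖) (‖f‖ * ‖g‖) :=
  (hasSum_norm_sigma f g).sigma fun s => (summable_fiber f g s).hasSum

/-- The convolution `(f * g)(s) = ∑_{x y = s} f(x) g(y)`. -/
def convFun (f g : EllOne S) (s : S) : ℂ := ∑' p : Fiber s, f p.1.1 * g p.1.2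

theorem norm_convFun_le (f g : EllOne S) (s : S) :
    ‖convFun f g s‖ ≤ ∑' p : Fiber s, ‖f p.1.1 * g p.1.2‖ :=
  norm_tsum_le_tsum_norm (summable_fiber f g s)

theorem summable_norm_convFun (f g : EllOne S) : Summable fun s => ‖convFun f g s‖ :=
  (hasSum_tsum_fiber f g).summable.of_nonneg_of_le (fun _ => norm_nonneg _) (norm_convFun_le f g)

/-- The convolution product on `ℓ¹(S)`. -/
instance : Mul (EllOne S) :=
  ⟨fun f g => ⟨convFun f g, memℓp_gen (by simpa using summable_norm_convFun f g)⟩⟩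

theorem mul_apply (f g : EllOne S) (s : S) :
    (f * g) s = ∑' p : Fiber s, f p.1.1 * g p.1.2 := rfl

theorem norm_mul_le' (f g : EllOne S) : ‖f * g‖ ≤ ‖f‖ * ‖g‖ :=
  hasSum_le (norm_convFun_le f g) (f * g).hasSum_norm (hasSum_tsum_fiber f g)

theorem mul_add' (f g h : EllOne S) : f * (g + h) = f * g + f * h := ext fun s => by
  simp only [mul_apply, add_apply, mul_add]
  exact (summable_fiber f g s).of_norm.tsum_add (summable_fiber f h s).of_norm

theorem add_mul' (f g h : EllOne S) : (f + g) * h = f * h + g * h := ext fun s => by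
  simp only [mul_apply, add_apply, add_mul]
  exact (summable_fiber f h s).of_norm.tsum_add (summable_fiber g h s).of_norm

theorem smul_mul' (c : ℂ) (f g : EllOne S) : (c • f) * g = c • (f * g) := ext fun s => by
  simp only [mul_apply, smul_apply, mul_assoc]
  exact tsum_mul_left

theorem mul_smul' (c : ℂ) (f g : EllOne S) : f * (c • g) = c • (f * g) := ext fun s => by
  simp only [mul_apply, smul_apply, mul_left_comm _ c]
  exact tsum_mul_left

/-- Convolution as a bounded bilinear map. -/
def mulL : EllOne S →L[ℂ] EllOne S →L[ℂ] EllOne S :=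
  LinearMap.mkContinuous₂
    (LinearMap.mk₂ ℂ (fun f g : EllOne S => f * g) add_mul' smul_mul' mul_add'
      (fun c f g => mul_smul' c f g))
    1 (fun f g => by simpa using norm_mul_le' f g)

@[simp] theorem mulL_apply (f g : EllOne S) : mulL f g = f * g := rfl

open Classical in
/-- The multiple `c δ_s` of a point mass. -/
def single (s : S) (c : ℂ) : EllOne S := lp.single 1 s c

theorem single_mul_single (s t : S) (c d : ℂ) :
    single s c * single t d = single (s * t) (c * d) := ext fun u => by
  classical
  rw [mul_apply]
  by_cases h : s * t = u
  · rw [tsum_eq_single (⟨(s, t), h⟩ : Fiber u)]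
    · subst h; simp [single]
    · rintro ⟨⟨x, y⟩, hxy⟩ hne
      by_cases hx : x = s
      · by_cases hy : y = t
        · exact absurd (Subtype.ext (Prod.ext hx hy)) hne
        · simp [single, hy]
      · simp [single, hx]
  · have : ∀ p : Fiber u, (single s c) p.1.1 * (single t d) p.1.2 = 0 := by
      rintro ⟨⟨x, y⟩, hxy⟩
      by_cases hx : x = s
      · by_cases hy : y = t
        · exact absurd (by rw [← hx, ← hy]; exact hxy) h
        · simp [single, hy]
      · simp [single, hx]
    rw [tsum_congr this, tsum_zero]
    simp [single, Ne.symm h]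

theorem hom_ext {G : Type*} [NormedAddCommGroup G] [NormedSpace ℂ G] {T U : EllOne S →L[ℂ] G}
    (h : ∀ s c, T (single s c) = U (single s c)) : T = U := by
  classical
  refine lp.ext_continuousLinearMap (E := fun _ : S => ℂ) (p := 1) (by simp) fun s => ?_
  ext
  convert h s 1 using 2 <;> simp [single] <;> congr!

theorem mul_assoc' (f g h : EllOne S) : f * g * h = f * (g * h) := by
  have e : (ContinuousLinearMap.compL ℂ (EllOne S) (EllOne S) (EllOne S →L[ℂ] EllOne S) mulL).comp
      mulL = ((ContinuousLinearMap.compL ℂ (EllOne S) (EllOne S →L[ℂ] EllOne S)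
        (EllOne S →L[ℂ] EllOne S)).flip mulL).comp
        ((ContinuousLinearMap.compL ℂ (EllOne S) (EllOne S) (EllOne S)).comp mulL) := by
    refine hom_ext fun s a => hom_ext fun t b => hom_ext fun u c => ?_
    simp [single_mul_single, mul_assoc]
  simpa using DFunLike.congr_fun (DFunLike.congr_fun (DFunLike.congr_fun e f) g) h

/-- `ℓ¹(S)` with convolution is a Banach algebra. -/
instance : NonUnitalNormedRing (EllOne S) where
  __ := (inferInstance : NormedAddCommGroup (EllOne S))
  __ := (inferInstance : Mul (EllOne S))
  left_distrib := mul_add'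
  right_distrib := add_mul'
  zero_mul f := (mulL (S := S)).map_zero₂ f
  mul_zero f := (mulL f).map_zero
  mul_assoc := mul_assoc'
  norm_mul_le := norm_mul_le'

instance : IsScalarTower ℂ (EllOne S) (EllOne S) := ⟨smul_mul'⟩

instance : SMulCommClass ℂ (EllOne S) (EllOne S) := ⟨fun c f g => (mul_smul' c f g).symm⟩

end EllOne

end EllOne

/-! ### Amenable groups -/

section Amenable

variable {G : Type*} [Group G]

/-- The left translate `(L_g f)(x) = f (g⁻¹ x)` of a bounded real function on `G`. -/
def leftTranslate (g : G) (f : lp (fun _ : G => ℝ) ∞) : lp (fun _ : G => ℝ) ∞ :=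
  ⟨fun x => f (g⁻¹ * x), memℓp_infty <| by
    obtain ⟨C, hC⟩ := (lp.memℓp f).bddAbove
    exact ⟨C, by rintro _ ⟨x, rfl⟩; exact hC ⟨g⁻¹ * x, rfl⟩⟩⟩

variable (G) in
/-- The discrete group `G` is amenable: there is a left invariant mean on `ℓ^∞(G)`, that is, a
positive linear functional `m` with `m(1) = 1` and `m(L_g f) = m(f)`. -/
def IsAmenableGroup : Prop :=
  ∃ m : lp (fun _ : G => ℝ) ∞ →ₗ[ℝ] ℝ,
    m 1 = 1 ∧ (∀ f : lp (fun _ : G => ℝ) ∞, (∀ x, 0 ≤ f x) → 0 ≤ m f) ∧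
      ∀ (g : G) (f : lp (fun _ : G => ℝ) ∞), m (leftTranslate g f) = m f

end Amenable

/-! ### Inverse semigroups and Clifford semigroups -/

section Semigroups

/-- An inverse semigroup: each `s` has a unique `t` with `s t s = s` and `t s t = t`. -/
class IsInverseSemigroup (S : Type*) [Semigroup S] : Prop where
  existsUnique_inverse (S) : ∀ s : S, ∃! t : S, s * t * s = s ∧ t * s * t = t

variable {S : Type*} [Semigroup S]

section Inverse

variable [IsInverseSemigroup S]

/-- The inverse `s*` of an element of an inverse semigroup. -/
def semiInv (s : S) : S := (IsInverseSemigroup.existsUnique_inverse S s).choose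

theorem mul_semiInv_mul (s : S) : s * semiInv s * s = s :=
  (IsInverseSemigroup.existsUnique_inverse S s).choose_spec.1.1

theorem semiInv_mul_semiInv (s : S) : semiInv s * s * semiInv s = semiInv s :=
  (IsInverseSemigroup.existsUnique_inverse S s).choose_spec.1.2

theorem eq_semiInv {s t : S} (h₁ : s * t * s = s) (h₂ : t * s * t = t) : t = semiInv s :=
  (IsInverseSemigroup.existsUnique_inverse S s).choose_spec.2 t ⟨h₁, h₂⟩

variable (S) in
/-- The set `E(S)` of idempotents. -/
abbrev Idempotents : Type _ := {e : S // IsIdempotentElem e}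

/-- The natural partial order: `s ≤ t` if and only if `s = s s* t`. -/
def NaturalLE (s t : S) : Prop := s = s * semiInv s * t

variable (S) in
/-- `E(S)` is uniformly locally finite: the sizes of the sets `(e] = {f ∈ E(S) : f ≤ e}`, for
`e ∈ E(S)`, are bounded by one finite constant. -/
def IdempotentsUniformlyLocallyFinite : Prop :=
  ∃ N : ℕ, ∀ e : Idempotents S, {f : Idempotents S | NaturalLE f.1 e.1}.encard ≤ N

/-- The maximal subgroup `G_e = {s : s s* = s* s = e}` at an idempotent `e`. -/
def MaximalSubgroup (e : Idempotents S) : Type _ :=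
  {s : S // s * semiInv s = e.1 ∧ semiInv s * s = e.1}

namespace MaximalSubgroup

variable {e : Idempotents S}

theorem left_id (s : MaximalSubgroup e) : e.1 * s.1 = s.1 := by
  have h := mul_semiInv_mul s.1
  rwa [s.2.1] at h

theorem right_id (s : MaximalSubgroup e) : s.1 * e.1 = s.1 := by
  have h := mul_semiInv_mul s.1
  rwa [mul_assoc, s.2.2] at h

theorem semiInv_semiInv (s : S) : semiInv (semiInv s) = s :=
  (eq_semiInv (semiInv_mul_semiInv s) (mul_semiInv_mul s)).symm

theorem semiInv_idem (e : Idempotents S) : semiInv e.1 = e.1 :=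
  (eq_semiInv (by rw [e.2.eq, e.2.eq]) (by rw [e.2.eq, e.2.eq])).symm

instance : One (MaximalSubgroup e) := ⟨⟨e.1, by rw [semiInv_idem, e.2.eq]; exact ⟨rfl, rfl⟩⟩⟩

instance : Inv (MaximalSubgroup e) := ⟨fun s => ⟨semiInv s.1, by
  rw [semiInv_semiInv]; exact ⟨s.2.2, s.2.1⟩⟩⟩

theorem inv_val (s : MaximalSubgroup e) : (s⁻¹).1 = semiInv s.1 := rfl

theorem mul_aux (s t : MaximalSubgroup e) :
    s.1 * t.1 * (semiInv t.1 * semiInv s.1) = e.1 ∧ semiInv t.1 * semiInv s.1 * (s.1 * t.1) = e.1 := by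
  constructor
  · rw [mul_assoc, ← mul_assoc t.1, t.2.1, ← mul_assoc, right_id, s.2.1]
  · rw [mul_assoc, ← mul_assoc (semiInv s.1), s.2.2, left_id, t.2.2]

theorem semiInv_mul (s t : MaximalSubgroup e) : semiInv (s.1 * t.1) = semiInv t.1 * semiInv s.1 := by
  refine (eq_semiInv ?_ ?_).symm
  · rw [(mul_aux s t).1, ← mul_assoc, left_id]
  · rw [(mul_aux s t).2, ← mul_assoc, ← inv_val t, left_id]

instance : Mul (MaximalSubgroup e) := ⟨fun s t => ⟨s.1 * t.1, by
  rw [semiInv_mul]; exact mul_aux s t⟩⟩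

/-- `G_e` is a group under the multiplication of `S`, with identity `e` and inverse `s*`. -/
instance : Group (MaximalSubgroup e) :=
  Group.ofLeftAxioms (fun a b c => Subtype.ext (mul_assoc a.1 b.1 c.1))
    (fun a => Subtype.ext (left_id a)) (fun a => Subtype.ext a.2.2)

end MaximalSubgroup

end Inverse

/-- A Clifford semigroup: an inverse semigroup in which `s s* = s* s` for every `s`. -/
class IsCliffordSemigroup (S : Type*) [Semigroup S] : Prop extends IsInverseSemigroup S where
  mul_semiInv_comm : ∀ s : S, s * semiInv s = semiInv s * s

end Semigroups

end PhiBiflat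

end

open PhiBiflat

open scoped TensorProduct ENNReal

set_option linter.unusedSectionVars false

namespace PhiBiflat

/-! ### Bounded operators on `ℓ¹(S)`, determined by their values on point masses -/

namespace EllOne

variable {S : Type*} [Semigroup S] {X : Type*} [NormedAddCommGroup X] [NormedSpace ℂ X]

/-! Amenability of the groups `G_e` is the hub: each of the other three conditions implies it, and
it implies each of them.

Necessity. Write `A = ℓ¹(S)`. Every flatness condition yields, for a character `φ` and an element
`e`, a functional `n ∈ A**` with `n(φ) = φ(e)` on which each `g` commuting with `e` acts as the
scalar `φ(g)` (`HasLocalMean`). From left `φ`-biflatness one takes `e · π**(ρ(b))` with `φ(b) = 1`;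
from biflatness, `(id ⊗ φ)**(ρ(e))`, since `ge = eg` gives `g · ρ(e) = ρ(e) · g`. For an idempotent
`e`, apply this to `δ_e` and to the character that is 1 on `δ_s` when `e ≤ ss*` and 0 otherwise.
Compression `δ_s ↦ δ_{es}` to `ℓ¹(G_e)` turns `n` into a `G_e`-invariant functional with value 1 at
the augmentation. It need be neither real nor positive; the positive part of its real part,
normalised, is an invariant mean (`isAmenableGroup_of_hasLocalMean`,
`isAmenableGroup_of_functional`).

Sufficiency. Lower sets in `E(S)` have at most `N` elements, so Möbius inversion gives central
idempotents `u_e` of uniformly bounded norm with `δ_e = ∑_{f ≤ e} u_f`. Here `δ_s u_e` vanishes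
unless `e ≤ ss*`, and otherwise equals `δ_{es} u_e` with `es ∈ G_e`. A mean on `G_e`, pushed along
`δ_g ↦ u_e δ_g ⊗ δ_{g⁻¹} u_e`, is a virtual diagonal for the summand of `u_e`; adding these over `e
≤ ss*` and acting by `δ_s` gives the bimodule splitting (`isBiflat_of_isAmenableGroup`). For a
character `φ`, let `e` be the least idempotent of its support. Twisting the mean on `G_e` by
`φ(δ_{g⁻¹})` and multiplying by `u_e` gives `m ∈ A**` with `a · m = φ(a) m` and `m(φ) = 1`
(`exists_mean_of_isAmenableGroup`). Such a `φ`-mean makes `A` left `φ`-biflat, and its image in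
`A****` does the same for `A**`. -/

theorem norm_single (s : S) (c : ℂ) : ‖single s c‖ = ‖c‖ := by
  let _ : DecidableEq S := fun a b => Classical.propDecidable (a = b)
  exact lp.norm_single (E := fun _ : S => ℂ) (p := 1) (by simp) s c

theorem single_smul (s : S) (c d : ℂ) : single s (c * d) = c • single s d := by
  classical
  exact lp.single_smul (E := fun _ : S => ℂ) 1 s c d

theorem single_eq_smul (s : S) (c : ℂ) : single s c = c • single s 1 := by
  rw [← single_smul, mul_one]

theorem single_apply [DecidableEq S] (s t : S) (c : ℂ) :
    (single s c) t = if t = s then c else 0 := by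
  by_cases h : t = s
  · subst h; simp [single]
  · simp [single, h]

/-- Bounded operators on `ℓ¹(S)` that agree on the point masses are equal. -/
theorem hom_ext_one {T U : EllOne S →L[ℂ] X}
    (h : ∀ s, T (single s 1) = U (single s 1)) : T = U :=
  hom_ext fun s c => by rw [single_eq_smul, map_smul, map_smul, h]

theorem summable_smul [CompleteSpace X] {x : S → X} {C : ℝ} (hx : ∀ s, ‖x s‖ ≤ C)
    (f : EllOne S) : Summable fun s => f s • x s := by
  refine Summable.of_norm_bounded (f.summable_norm.mul_right C) fun s => ?_
  rw [norm_smul]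
  exact mul_le_mul_of_nonneg_left (hx s) (norm_nonneg _)

/-- The bounded operator on `ℓ¹(S)` that extends a bounded function `x` on `S`. -/
noncomputable def extend [CompleteSpace X] (x : S → X) (C : ℝ) (hx : ∀ s, ‖x s‖ ≤ C) :
    EllOne S →L[ℂ] X :=
  LinearMap.mkContinuous
    { toFun := fun f => ∑' s, f s • x s
      map_add' := fun f g => by
        simp only [add_apply, add_smul]
        exact (summable_smul hx f).tsum_add (summable_smul hx g)
      map_smul' := fun c f => by
        simp only [smul_apply, mul_smul, RingHom.id_apply]
        exact (summable_smul hx f).tsum_const_smul c }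
    C fun f => by
      rw [mul_comm]
      refine tsum_of_norm_bounded (f.hasSum_norm.mul_right C) fun s => ?_
      rw [norm_smul]
      exact mul_le_mul_of_nonneg_left (hx s) (norm_nonneg _)

@[simp] theorem extend_single [CompleteSpace X] (x : S → X) (C : ℝ) (hx : ∀ s, ‖x s‖ ≤ C)
    (s : S) : extend x C hx (single s 1) = x s := by
  classical
  change ∑' t, (single s 1) t • x t = x s
  rw [tsum_eq_single s]
  · simp [single_apply]
  · intro t ht
    simp [single_apply, ht]

theorem norm_extend_le [CompleteSpace X] (x : S → X) (C : ℝ) (hC : 0 ≤ C)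
    (hx : ∀ s, ‖x s‖ ≤ C) : ‖extend x C hx‖ ≤ C :=
  LinearMap.mkContinuous_norm_le _ hC _

end EllOne

/-- Bounded operators on `E ⊗_p F` that agree on the elementary tensors are equal. -/
theorem ProjTensor.hom_ext {E F G : Type*} [NormedAddCommGroup E] [NormedSpace ℂ E]
    [NormedAddCommGroup F] [NormedSpace ℂ F] [NormedAddCommGroup G] [NormedSpace ℂ G]
    {T U : ProjTensor E F →L[ℂ] G}
    (h : ∀ x y, T (ProjTensor.tmul x y) = U (ProjTensor.tmul x y)) : T = U := by
  refine ContinuousLinearMap.ext fun u => ?_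
  induction u using UniformSpace.Completion.induction_on with
  | hp => exact isClosed_eq T.continuous U.continuous
  | ih u =>
    obtain ⟨s, hs⟩ := TensorProduct.exists_multiset (R := ℂ) (M := E) (N := F) u
    have hu : (u : ProjTensor E F) = (s.map fun p => ProjTensor.tmul p.1 p.2).sum := by
      have : ∀ s : Multiset (E × F),
          (((s.map fun p => AlgTensor.mk p.1 p.2).sum : AlgTensor E F) : ProjTensor E F) =
            (s.map fun p => ProjTensor.tmul p.1 p.2).sum := by
        intro s
        induction s using Multiset.induction_on with
        | empty => exact UniformSpace.Completion.coe_zero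
        | cons a s ih =>
          rw [Multiset.map_cons, Multiset.sum_cons, UniformSpace.Completion.coe_add, ih,
            Multiset.map_cons, Multiset.sum_cons]
          rfl
      rw [← this]
      exact congrArg _ hs
    rw [hu, map_multiset_sum, map_multiset_sum, Multiset.map_map, Multiset.map_map]
    exact congrArg _ (Multiset.map_congr rfl fun p _ => h p.1 p.2)

/-! ### Means attached to a character, and their relation to biflatness -/

section Mean

variable {A : Type*} [NonUnitalNormedRing A] [NormedSpace ℂ A] [IsScalarTower ℂ A A]
  [SMulCommClass ℂ A A]

/-- Left multiplication by `a` on a Banach algebra. -/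
noncomputable abbrev mulLeft (a : A) : A →L[ℂ] A := ContinuousLinearMap.mul ℂ A a

/-- A character of `A`, as an element of the dual. -/
noncomputable abbrev charDual (φ : WeakDual.characterSpace ℂ A) : StrongDual ℂ A :=
  WeakDual.toStrongDual φ.1

theorem charDual_mul (φ : WeakDual.characterSpace ℂ A) (a b : A) :
    charDual φ (a * b) = charDual φ a * charDual φ b := φ.2.2 a b

theorem exists_char_eq_one (φ : WeakDual.characterSpace ℂ A) : ∃ b, charDual φ b = 1 := by
  by_contra! h
  refine φ.2.1 (DFunLike.ext _ _ fun a => ?_)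
  by_contra ha
  refine h ((φ.1 a)⁻¹ • a) ?_
  rw [map_smul]
  exact inv_mul_cancel₀ ha

theorem Bidual.map_comp {E F G : Type*} [NormedAddCommGroup E] [NormedSpace ℂ E]
    [NormedAddCommGroup F] [NormedSpace ℂ F] [NormedAddCommGroup G] [NormedSpace ℂ G]
    (T : F →L[ℂ] G) (U : E →L[ℂ] F) (m : Bidual E) :
    Bidual.map T (Bidual.map U m) = Bidual.map (T.comp U) m := rfl

theorem Bidual.map_smul_left {E F : Type*} [NormedAddCommGroup E] [NormedSpace ℂ E]
    [NormedAddCommGroup F] [NormedSpace ℂ F] (c : ℂ) (T : E →L[ℂ] F) (m : Bidual E) :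
    Bidual.map (c • T) m = c • Bidual.map T m := by
  refine Bidual.ext fun f => ?_
  have : dualMap (c • T) f = c • dualMap T f := by ext x; simp
  rw [Bidual.map_apply, this, map_smul]
  rfl

theorem Bidual.map_incl {E F : Type*} [NormedAddCommGroup E] [NormedSpace ℂ E]
    [NormedAddCommGroup F] [NormedSpace ℂ F] (T : E →L[ℂ] F) (x : E) :
    Bidual.map T (Bidual.incl E x) = Bidual.incl F (T x) := rfl

theorem mulLeft_comp (a b : A) : (mulLeft a).comp (mulLeft b) = mulLeft (a * b) := by
  ext x
  exact (mul_assoc a b x).symm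

/-- A `φ`-mean on `A**` makes `A` left `φ`-biflat. -/
theorem isLeftBiflat_of_mean [CompleteSpace A] (φ : WeakDual.characterSpace ℂ A) (m : Bidual A)
    (hm : ∀ a, Bidual.map (mulLeft a) m = charDual φ a • m) (h1 : m (charDual φ) = 1) :
    IsLeftBiflat A φ := by
  obtain ⟨b, hb⟩ := exists_char_eq_one φ
  -- With `T x = x ⊗ b` and `φ(b) = 1`, the splitting is `ρ(a) = φ(a) T**(m)`: `T` is a left module
  -- map, and `φ ∘ π ∘ T = φ`.
  let T : A →L[ℂ] ProjTensor A A := ProjTensor.tmul.flip b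
  have hT : ∀ a, bidualLeftAct a (Bidual.map T m) = charDual φ a • Bidual.map T m := by
    intro a
    have h : (leftAct a).comp T = T.comp (mulLeft a) := by
      ext x
      exact leftAct_tmul a x b
    rw [bidualLeftAct, Bidual.map_comp, h, ← Bidual.map_comp, hm, map_smul]
  refine ⟨(charDual φ).smulRight (Bidual.map T m), fun x y => ?_, fun x y => ?_, fun x => ?_⟩
  · rw [ContinuousLinearMap.smulRight_apply, ContinuousLinearMap.smulRight_apply, charDual_mul,
      mul_comm, mul_smul]
    rfl
  · rw [ContinuousLinearMap.smulRight_apply, ContinuousLinearMap.smulRight_apply, charDual_mul,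
      map_smul, hT, smul_smul, mul_comm]
  · rw [ContinuousLinearMap.smulRight_apply, map_smul, map_smul, bidualCharacter_apply,
      Bidual.map_comp, Bidual.map_apply]
    have h : dualMap ((prodMap A).comp T) (charDual φ) = charDual φ := by
      ext x
      have : prodMap A (T x) = x * b := prodMap_tmul x b
      rw [dualMap_apply, ContinuousLinearMap.comp_apply, this, charDual_mul, hb, mul_one]
    rw [h, h1]
    exact mul_one _

/-- A `φ`-mean on `A**` makes `A**` left biflat for the extension of `φ`. -/
theorem isLeftBiflat_bidual_of_mean (φ : WeakDual.characterSpace ℂ A)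
    (m : Bidual A) (hm : ∀ a, Bidual.map (mulLeft a) m = charDual φ a • m)
    (h1 : m (charDual φ) = 1) : IsLeftBiflat (Bidual A) (bidualCharacter φ) := by
  refine isLeftBiflat_of_mean _ (Bidual.incl _ m) (fun b => ?_) h1
  rw [Bidual.map_incl, ← map_smul]
  congr 1
  refine Bidual.ext fun f => ?_
  -- Evaluating the mean property at `f` gives `m · f = m(f) φ`, hence `b □ m = φ̃(b) m` for every
  -- `b ∈ A**`, not just for `b ∈ A`.
  have h : Bidual.arensAct m f = m f • charDual φ := by
    ext a
    have := congrArg (fun k : Bidual A => k f) (hm a)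
    exact this.trans (mul_comm _ _)
  change b (Bidual.arensAct m f) = b (charDual φ) * m f
  rw [h, map_smul, smul_eq_mul, mul_comm]

/-- There is a functional on `A*` with `n(φ) = φ(e)` on which every element commuting with `e`
acts by its value under `φ`. -/
def HasLocalMean (φ : WeakDual.characterSpace ℂ A) (e : A) : Prop :=
  ∃ n : Bidual A, n (charDual φ) = charDual φ e ∧
    ∀ g, g * e = e * g → Bidual.map (mulLeft g) n = charDual φ g • n

/-- The functional `e · n` works: `g · (e · n) = (eg) · n = φ(g) (e · n)` once `g` is moved past
`e`. The quasi-mean relation alone only absorbs factors on the right, which is why commutation is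
needed. -/
theorem hasLocalMean_of_quasiMean (φ : WeakDual.characterSpace ℂ A) (n : Bidual A)
    (h1 : n (charDual φ) = 1)
    (hn : ∀ a b, Bidual.map (mulLeft (a * b)) n = charDual φ b • Bidual.map (mulLeft a) n)
    (e : A) : HasLocalMean φ e := by
  refine ⟨Bidual.map (mulLeft e) n, ?_, fun g hg => ?_⟩
  · have h : dualMap (mulLeft e) (charDual φ) = charDual φ e • charDual φ := by
      ext x
      exact charDual_mul φ e x
    rw [Bidual.map_apply, h, map_smul, h1, smul_eq_mul, mul_one]
  · rw [Bidual.map_comp, mulLeft_comp, hg, hn]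

/-- Take `n = π**(ρ(b))` with `φ(b) = 1`. Then `a · n = π**(ρ(ab)) = π**(ρ(a))`, and the relation
for `n` is the relation `ρ(ab) = φ(b) ρ(a)` pushed through `π**`. -/
theorem exists_quasiMean_of_isLeftBiflat [CompleteSpace A] {φ : WeakDual.characterSpace ℂ A}
    (h : IsLeftBiflat A φ) : ∃ n : Bidual A, n (charDual φ) = 1 ∧
      ∀ a b, Bidual.map (mulLeft (a * b)) n = charDual φ b • Bidual.map (mulLeft a) n := by
  obtain ⟨ρ, h1, h2, h3⟩ := h
  obtain ⟨b, hb⟩ := exists_char_eq_one φ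
  have key : ∀ a, Bidual.map (mulLeft a) (Bidual.map (prodMap A) (ρ b)) =
      Bidual.map (prodMap A) (ρ a) := by
    intro a
    have : (mulLeft a).comp (prodMap A) = (prodMap A).comp (leftAct a) :=
      ProjTensor.hom_ext fun x y => by simp [mul_assoc]
    rw [Bidual.map_comp, this, ← Bidual.map_comp]
    change Bidual.map (prodMap A) (bidualLeftAct a (ρ b)) = _
    rw [← h2, h1]
    change Bidual.map (prodMap A) (charDual φ b • ρ a) = _
    rw [hb, one_smul]
  refine ⟨Bidual.map (prodMap A) (ρ b), (h3 b).trans hb, fun x y => ?_⟩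
  rw [key, key, h1, map_smul]
  rfl

theorem hasLocalMean_of_isLeftBiflat [CompleteSpace A] {φ : WeakDual.characterSpace ℂ A}
    (h : IsLeftBiflat A φ) (e : A) : HasLocalMean φ e := by
  obtain ⟨n, h1, hn⟩ := exists_quasiMean_of_isLeftBiflat h
  exact hasLocalMean_of_quasiMean φ n h1 hn e

/-- A quasi-mean for `A**` lives in `A****`; restricting it along the canonical embedding `A* →
A***` gives one for `A`. -/
theorem hasLocalMean_of_isLeftBiflat_bidual {φ : WeakDual.characterSpace ℂ A}
    (h : IsLeftBiflat (Bidual A) (bidualCharacter φ)) (e : A) : HasLocalMean φ e := by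
  obtain ⟨N, h1, hN⟩ := exists_quasiMean_of_isLeftBiflat h
  let J : StrongDual ℂ A →L[ℂ] StrongDual ℂ (Bidual A) :=
    NormedSpace.inclusionInDoubleDual ℂ (StrongDual ℂ A)
  refine hasLocalMean_of_quasiMean φ (Bidual.toDual.symm ((Bidual.toDual N).comp J)) h1
    (fun a b => ?_) e
  refine Bidual.ext fun f => ?_
  have := congrArg (fun k : Bidual (Bidual A) =>
    k (J f))
    (hN (Bidual.incl A a) (Bidual.incl A b))
  exact this

/-- Slice with `T = id ⊗ φ`: it is a left module map that converts the right action of `g` into the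
scalar `φ(g)`, and `φ ∘ T = φ ∘ π`. -/
theorem hasLocalMean_of_isBiflat [CompleteSpace A] (h : IsBiflat A)
    (φ : WeakDual.characterSpace ℂ A) (e : A) : HasLocalMean φ e := by
  obtain ⟨ρ, h1, h2, h3⟩ := h
  let T : ProjTensor A A →L[ℂ] A :=
    ProjTensor.lift ((ContinuousLinearMap.lsmul ℂ ℂ).comp (charDual φ)).flip
  have hT : ∀ x y, T (ProjTensor.tmul x y) = charDual φ y • x := fun x y => by simp [T]
  refine ⟨Bidual.map T (ρ e), ?_, fun g hg => ?_⟩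
  · have h : dualMap T (charDual φ) = dualMap (prodMap A) (charDual φ) :=
      ProjTensor.hom_ext fun x y => by
        rw [dualMap_apply, dualMap_apply, hT, prodMap_tmul, map_smul, charDual_mul, smul_eq_mul,
          mul_comm]
    rw [Bidual.map_apply, h]
    exact congrArg (fun k : Bidual A => k (charDual φ)) (h3 e)
  · have e1 : (mulLeft g).comp T = T.comp (leftAct g) := ProjTensor.hom_ext fun x y => by
      simp [hT]
    have e2 : T.comp (rightAct g) = charDual φ g • T := ProjTensor.hom_ext fun x y => by
      simp only [ContinuousLinearMap.comp_apply, rightAct_tmul, hT, charDual_mul,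
        _root_.smul_apply, smul_smul, mul_comm]
    have e3 : Bidual.map (leftAct g) (ρ e) = Bidual.map (rightAct g) (ρ e) :=
      (h1 g e).symm.trans ((congrArg ρ hg).trans (h2 e g))
    rw [Bidual.map_comp, e1, ← Bidual.map_comp, e3, Bidual.map_comp, e2, Bidual.map_smul_left]

end Mean

/-! ### The positive part of a bounded functional on `ℓ^∞(G)` -/

section PositivePart

variable {G : Type*}

/-- The bounded real functions on `G`. -/
abbrev BddFun (G : Type*) : Type _ := lp (fun _ : G => ℝ) ∞

namespace BddFun

@[simp] theorem coe_add (f g : BddFun G) (x : G) : (f + g) x = f x + g x := rfl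
@[simp] theorem coe_sub (f g : BddFun G) (x : G) : (f - g) x = f x - g x := rfl
@[simp] theorem coe_neg (f : BddFun G) (x : G) : (-f) x = -f x := rfl
@[simp] theorem coe_smul (c : ℝ) (f : BddFun G) (x : G) : (c • f) x = c * f x := rfl
@[simp] theorem coe_zero (x : G) : (0 : BddFun G) x = 0 := rfl
@[simp] theorem coe_one (x : G) : (1 : BddFun G) x = 1 := by rw [lp.infty_coeFn_one]; rfl

theorem abs_apply_le (f : BddFun G) (x : G) : |f x| ≤ ‖f‖ :=
  lp.norm_apply_le_norm (by simp) f x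

/-- The pointwise minimum. -/
noncomputable def inf (f g : BddFun G) : BddFun G :=
  ⟨fun x => min (f x) (g x), memℓp_infty ⟨max ‖f‖ ‖g‖, by
    rintro _ ⟨x, rfl⟩
    exact abs_min_le_max_abs_abs.trans (max_le_max (abs_apply_le f x) (abs_apply_le g x))⟩⟩

@[simp] theorem inf_apply (f g : BddFun G) (x : G) : inf f g x = min (f x) (g x) := rfl

/-- The positive part `f ∨ 0`. -/
noncomputable def pos (f : BddFun G) : BddFun G := f - inf f 0

theorem pos_nonneg (f : BddFun G) (x : G) : 0 ≤ pos f x := by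
  simp [pos]

theorem pos_sub_nonneg (f : BddFun G) (x : G) : 0 ≤ (pos f - f) x := by
  simp [pos]

/-- The functions `h` with `0 ≤ h ≤ f`. -/
def interval (f : BddFun G) : Set (BddFun G) := {h | ∀ x, 0 ≤ h x ∧ h x ≤ f x}

theorem norm_le_of_mem_interval {f h : BddFun G} (hh : h ∈ interval f) : ‖h‖ ≤ ‖f‖ :=
  lp.norm_le_of_forall_le (norm_nonneg _) fun x => by
    rw [Real.norm_of_nonneg (hh x).1]
    exact (hh x).2.trans ((le_abs_self _).trans (abs_apply_le f x))

/-- `ν⁺(f) = sup {ν(h) : 0 ≤ h ≤ f}`, for `f ≥ 0`. -/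
noncomputable def upper (ν : BddFun G →L[ℝ] ℝ) (f : BddFun G) : ℝ := sSup (ν '' interval f)

variable (ν : BddFun G →L[ℝ] ℝ)

theorem le_upper {f h : BddFun G} (hh : h ∈ interval f) : ν h ≤ upper ν f := by
  refine le_csSup ⟨‖ν‖ * ‖f‖, ?_⟩ ⟨h, hh, rfl⟩
  rintro _ ⟨k, hk, rfl⟩
  refine ((le_abs_self _).trans (ν.le_opNorm k)).trans ?_
  gcongr
  exact norm_le_of_mem_interval hk

theorem zero_mem_interval {f : BddFun G} (hf : ∀ x, 0 ≤ f x) : (0 : BddFun G) ∈ interval f :=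
  fun x => ⟨le_rfl, hf x⟩

theorem upper_le {f : BddFun G} (hf : ∀ x, 0 ≤ f x) {c : ℝ} (h : ∀ k ∈ interval f, ν k ≤ c) :
    upper ν f ≤ c := by
  refine csSup_le ⟨_, 0, zero_mem_interval hf, rfl⟩ ?_
  rintro _ ⟨k, hk, rfl⟩
  exact h k hk

theorem upper_nonneg {f : BddFun G} (hf : ∀ x, 0 ≤ f x) : 0 ≤ upper ν f := by
  simpa using le_upper ν (zero_mem_interval hf)

/-- Riesz decomposition: any `0 ≤ k ≤ f + g` splits as `k ∧ f` below `f` and `k - k ∧ f` below `g`.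
The other inequality adds elements of the two intervals. -/
theorem upper_add {f g : BddFun G} (hf : ∀ x, 0 ≤ f x) (hg : ∀ x, 0 ≤ g x) :
    upper ν (f + g) = upper ν f + upper ν g := by
  apply le_antisymm
  · refine upper_le ν (fun x => add_nonneg (hf x) (hg x)) fun k hk => ?_
    have h1 : inf k f ∈ interval f := fun x => ⟨le_min (hk x).1 (hf x), min_le_right _ _⟩
    have h2 : k - inf k f ∈ interval g := fun x => by
      have := hk x
      simp only [coe_add, coe_sub, inf_apply] at *
      rcases min_cases (k x) (f x) with h | h <;> rw [h.1] <;> constructor <;>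
        linarith [hg x]
    have := add_le_add (le_upper ν h1) (le_upper ν h2)
    rwa [← map_add, add_sub_cancel] at this
  · have h : ∀ k ∈ interval f, upper ν g ≤ upper ν (f + g) - ν k := fun k hk =>
      upper_le ν hg fun l hl => by
        have : k + l ∈ interval (f + g) := fun x =>
          ⟨add_nonneg (hk x).1 (hl x).1, add_le_add (hk x).2 (hl x).2⟩
        have := le_upper ν this
        rw [map_add] at this
        linarith
    have := upper_le ν hf (c := upper ν (f + g) - upper ν g) fun k hk => by linarith [h k hk]
    linarith

theorem upper_smul {f : BddFun G} (hf : ∀ x, 0 ≤ f x) {c : ℝ} (hc : 0 ≤ c) :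
    upper ν (c • f) = c * upper ν f := by
  have key : ∀ {f : BddFun G} {c : ℝ}, (∀ x, 0 ≤ f x) → 0 < c →
      c * upper ν f ≤ upper ν (c • f) := by
    intro f c hf hc
    rw [mul_comm, ← le_div_iff₀ hc]
    refine upper_le ν hf fun k hk => ?_
    rw [le_div_iff₀ hc, mul_comm]
    have : c • k ∈ interval (c • f) := fun x =>
      ⟨mul_nonneg hc.le (hk x).1, mul_le_mul_of_nonneg_left (hk x).2 hc.le⟩
    simpa using le_upper ν this
  -- For `c > 0` the inequality `key` is used twice, with `c` and with `c⁻¹`; `c = 0` is separate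
  -- because then the interval is `{0}`.
  rcases hc.eq_or_lt with rfl | hc
  · rw [zero_smul, zero_mul]
    refine le_antisymm (upper_le ν (fun _ => le_rfl) fun k hk => ?_)
      (upper_nonneg ν fun _ => le_rfl)
    have : k = 0 := lp.ext (funext fun x => le_antisymm (hk x).2 (hk x).1)
    rw [this, map_zero]
  · refine le_antisymm ?_ (key hf hc)
    have := key (f := c • f) (fun x => mul_nonneg hc.le (hf x)) (inv_pos.2 hc)
    rwa [smul_smul, inv_mul_cancel₀ hc.ne', one_smul, ← div_eq_inv_mul, div_le_iff₀' hc] at this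

/-- The extension of `ν⁺` to all bounded functions by differences is well defined. -/
theorem upper_sub_upper {f a b : BddFun G} (ha : ∀ x, 0 ≤ a x) (hb : ∀ x, 0 ≤ b x)
    (h : f = a - b) : upper ν (pos f) - upper ν (pos f - f) = upper ν a - upper ν b := by
  have : pos f + b = a + (pos f - f) := by rw [h]; abel
  have h1 := upper_add ν (pos_nonneg f) hb
  rw [this, upper_add ν ha (pos_sub_nonneg f)] at h1
  linarith

/-- The positive part of a bounded functional on the bounded functions. -/
noncomputable def positivePart : BddFun G →ₗ[ℝ] ℝ where
  toFun f := upper ν (pos f) - upper ν (pos f - f)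
  map_add' f g := by
    rw [upper_sub_upper ν (f := f + g) (a := pos f + pos g) (b := (pos f - f) + (pos g - g))
      (fun x => add_nonneg (pos_nonneg f x) (pos_nonneg g x))
      (fun x => add_nonneg (pos_sub_nonneg f x) (pos_sub_nonneg g x)) (by abel),
      upper_add ν (pos_nonneg f) (pos_nonneg g),
      upper_add ν (pos_sub_nonneg f) (pos_sub_nonneg g)]
    ring
  map_smul' c f := by
    rw [RingHom.id_apply, smul_eq_mul]
    rcases le_total 0 c with hc | hc
    · rw [upper_sub_upper ν (f := c • f) (a := c • pos f) (b := c • (pos f - f))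
        (fun x => mul_nonneg hc (pos_nonneg f x)) (fun x => mul_nonneg hc (pos_sub_nonneg f x))
        (by rw [← smul_sub, sub_sub_cancel]),
        upper_smul ν (pos_nonneg f) hc, upper_smul ν (pos_sub_nonneg f) hc]
      ring
    -- A negative scalar exchanges the roles of the positive part `pos f` and the negative part `pos
    -- f - f`.
    · have hc' : 0 ≤ -c := neg_nonneg.2 hc
      rw [upper_sub_upper ν (f := c • f) (a := (-c) • (pos f - f)) (b := (-c) • pos f)
        (fun x => mul_nonneg hc' (pos_sub_nonneg f x)) (fun x => mul_nonneg hc' (pos_nonneg f x))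
        (by rw [← smul_sub]; simp),
        upper_smul ν (pos_nonneg f) hc', upper_smul ν (pos_sub_nonneg f) hc']
      ring

theorem positivePart_of_nonneg {f : BddFun G} (hf : ∀ x, 0 ≤ f x) :
    positivePart ν f = upper ν f := by
  have h0 : upper ν 0 = 0 := by simpa using upper_smul ν hf le_rfl
  have := upper_sub_upper ν (f := f) hf (fun _ => le_rfl) (sub_zero f).symm
  rw [h0, sub_zero] at this
  exact this

end BddFun

end PositivePart

/-! ### Invariant means and invariant functionals on the dual of `ℓ¹(G)` -/

section Translate

variable {G : Type*} [Group G]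

open BddFun

@[simp] theorem leftTranslate_apply (g : G) (f : BddFun G) (x : G) :
    leftTranslate g f x = f (g⁻¹ * x) := rfl

theorem leftTranslate_inv_leftTranslate (g : G) (f : BddFun G) :
    leftTranslate g⁻¹ (leftTranslate g f) = f :=
  lp.ext (funext fun x => by simp)

theorem leftTranslate_mem_interval {g : G} {f h : BddFun G} (hh : h ∈ interval f) :
    leftTranslate g h ∈ interval (leftTranslate g f) := fun x => hh (g⁻¹ * x)

/-- Translation carries the interval below `f` into the one below its translate and preserves `ν`;
this gives one inequality for all `g`, and `g⁻¹` gives the reverse. -/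
theorem upper_leftTranslate {ν : BddFun G →L[ℝ] ℝ} (hν : ∀ g f, ν (leftTranslate g f) = ν f)
    (g : G) {f : BddFun G} (hf : ∀ x, 0 ≤ f x) : upper ν (leftTranslate g f) = upper ν f := by
  have key : ∀ (g : G) {f : BddFun G}, (∀ x, 0 ≤ f x) →
      upper ν f ≤ upper ν (leftTranslate g f) := fun g f hf =>
    upper_le ν hf fun k hk => by
      rw [← hν g]
      exact le_upper ν (leftTranslate_mem_interval hk)
  refine le_antisymm ?_ (key g hf)
  have := key g⁻¹ (f := leftTranslate g f) fun x => hf _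
  rwa [leftTranslate_inv_leftTranslate] at this

theorem positivePart_leftTranslate {ν : BddFun G →L[ℝ] ℝ}
    (hν : ∀ g f, ν (leftTranslate g f) = ν f) (g : G) (f : BddFun G) :
    positivePart ν (leftTranslate g f) = positivePart ν f := by
  have h : leftTranslate g (pos f) - leftTranslate g f = leftTranslate g (pos f - f) := rfl
  have h' : pos (leftTranslate g f) = leftTranslate g (pos f) := rfl
  change upper ν (pos _) - upper ν (pos _ - _) = upper ν _ - upper ν _
  rw [h', h, upper_leftTranslate hν g (pos_nonneg f), upper_leftTranslate hν g (pos_sub_nonneg f)]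

/-- A left invariant bounded functional with `ν(1) = 1` yields a left invariant mean. -/
theorem isAmenableGroup_of_functional (ν : BddFun G →L[ℝ] ℝ) (h1 : ν 1 = 1)
    (hν : ∀ g f, ν (leftTranslate g f) = ν f) : IsAmenableGroup G := by
  have hpos : ∀ x, (0 : ℝ) ≤ (1 : BddFun G) x := fun x => by simp
  -- The constant 1 lies in its own interval, so `ν⁺(1) ≥ ν(1) = 1` and division by `ν⁺(1)` is
  -- allowed.
  have hc : 1 ≤ positivePart ν 1 := by
    rw [positivePart_of_nonneg ν hpos, ← h1]
    exact le_upper ν fun x => ⟨hpos x, le_rfl⟩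
  refine ⟨(positivePart ν 1)⁻¹ • positivePart ν, ?_, fun f hf => ?_, fun g f => ?_⟩
  · exact inv_mul_cancel₀ (by positivity)
  · change 0 ≤ (positivePart ν 1)⁻¹ * positivePart ν f
    rw [positivePart_of_nonneg ν hf]
    have := upper_nonneg ν hf
    positivity
  · change (positivePart ν 1)⁻¹ * _ = (positivePart ν 1)⁻¹ * _
    rw [positivePart_leftTranslate hν]

/-- The augmentation functional `f ↦ ∑ f(s)` of `ℓ¹(G)`. -/
noncomputable def augmentation (G : Type*) [Semigroup G] : StrongDual ℂ (EllOne G) :=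
  EllOne.extend (fun _ => 1) 1 (by simp)

/-- The functional on `ℓ¹(G)` given by a bounded real function on `G`. -/
noncomputable def realFunctional : BddFun G →L[ℝ] StrongDual ℂ (EllOne G) :=
  LinearMap.mkContinuous
    { toFun := fun f => EllOne.extend (fun x => (f x : ℂ)) ‖f‖ fun x => by
        rw [Complex.norm_real]; exact abs_apply_le f x
      map_add' := fun f g => EllOne.hom_ext_one fun s => by simp
      map_smul' := fun c f => EllOne.hom_ext_one fun s => by simp }
    1 fun f => by
      rw [one_mul]
      exact EllOne.norm_extend_le (fun x => (f x : ℂ)) _ (norm_nonneg _) fun x => by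
        rw [Complex.norm_real]; exact abs_apply_le f x

@[simp] theorem realFunctional_single (f : BddFun G) (x : G) :
    realFunctional f (EllOne.single x 1) = f x :=
  EllOne.extend_single (fun x => (f x : ℂ)) ‖f‖
    (fun x => by rw [Complex.norm_real]; exact abs_apply_le f x) x

/-- Real bounded functions embed in the dual of `ℓ¹(G)`, with 1 going to the augmentation; the real
part of `m` there is an invariant bounded functional to which the positive-part argument applies. -/
theorem isAmenableGroup_of_bidual (m : Bidual (EllOne G)) (h1 : m (augmentation G) = 1)
    (hm : ∀ g, Bidual.map (mulLeft (EllOne.single g 1)) m = m) : IsAmenableGroup G := by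
  let ν : BddFun G →L[ℝ] ℝ :=
    Complex.reCLM.comp (((Bidual.toDual m).restrictScalars ℝ).comp realFunctional)
  have hν : ∀ f, ν f = (m (realFunctional f)).re := fun f => rfl
  refine isAmenableGroup_of_functional ν ?_ fun g f => ?_
  · have : realFunctional (1 : BddFun G) = augmentation G :=
      EllOne.hom_ext_one fun s => by simp [augmentation]
    rw [hν, this, h1, Complex.one_re]
  · have : dualMap (mulLeft (EllOne.single g 1)) (realFunctional (leftTranslate g f)) =
        realFunctional f :=
      EllOne.hom_ext_one fun s => by simp [EllOne.single_mul_single]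
    rw [hν, hν, ← this, ← Bidual.map_apply, hm]

/-- The real part of a functional on `ℓ¹(G)`, as a bounded function. -/
noncomputable def rePart : StrongDual ℂ (EllOne G) →ₗ[ℝ] BddFun G where
  toFun f := ⟨fun x => (f (EllOne.single x 1)).re, memℓp_infty ⟨‖f‖, by
    rintro _ ⟨x, rfl⟩
    refine (Complex.abs_re_le_norm _).trans ((f.le_opNorm _).trans ?_)
    simp [EllOne.norm_single]⟩⟩
  map_add' f g := lp.ext (funext fun x => by simp)
  map_smul' c f := lp.ext (funext fun x => by simp)

@[simp] theorem rePart_apply (f : StrongDual ℂ (EllOne G)) (x : G) :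
    rePart f x = (f (EllOne.single x 1)).re := rfl

theorem abs_rePart_le (f : StrongDual ℂ (EllOne G)) (x : G) : |rePart f x| ≤ ‖f‖ := by
  refine (Complex.abs_re_le_norm _).trans ((f.le_opNorm _).trans ?_)
  simp [EllOne.norm_single]

/-- The converse passage: compose the mean with the real part to get a real-linear functional, then
complexify. Positivity gives norm at most 1, which later keeps the sum over idempotents bounded. -/
theorem exists_bidual_of_isAmenableGroup (h : IsAmenableGroup G) :
    ∃ m : Bidual (EllOne G), ‖m‖ ≤ 1 ∧ m (augmentation G) = 1 ∧
      ∀ g, Bidual.map (mulLeft (EllOne.single g 1)) m = m := by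
  obtain ⟨μ, h1, hpos, hinv⟩ := h
  have hmono : ∀ f k : BddFun G, (∀ x, f x ≤ k x) → μ f ≤ μ k := fun f k hfk => by
    have := hpos (k - f) fun x => sub_nonneg.2 (hfk x)
    rw [map_sub] at this
    linarith
  have hbd : ∀ f, |μ (rePart f)| ≤ 1 * ‖f‖ := fun f => by
    have hc : ∀ c : ℝ, μ (c • 1) = c := fun c => by rw [map_smul, h1, smul_eq_mul, mul_one]
    rw [abs_le, one_mul]
    constructor
    · rw [← hc (-‖f‖)]
      refine hmono _ _ fun x => ?_
      simpa using (abs_le.1 (abs_rePart_le f x)).1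
    · rw [← hc ‖f‖]
      refine hmono _ _ fun x => ?_
      simpa using (abs_le.1 (abs_rePart_le f x)).2
  let r : StrongDual ℝ (StrongDual ℂ (EllOne G)) :=
    LinearMap.mkContinuous (μ.comp rePart) 1 hbd
  have hr : ∀ f, r f = μ (rePart f) := fun f => rfl
  let m : Bidual (EllOne G) := Bidual.toDual.symm (StrongDual.extendRCLike (𝕜 := ℂ) r)
  -- The complexification is `f ↦ r(f) - i r(if)`; it has the same norm as `r`, and inherits its
  -- invariance.
  have hm : ∀ f, m f = (r f : ℂ) - Complex.I * (r (Complex.I • f) : ℂ) := fun f =>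
    StrongDual.extendRCLike_apply r f
  have hnorm : ‖m‖ ≤ 1 :=
    (StrongDual.norm_extendRCLike (𝕜 := ℂ) r).le.trans
      (LinearMap.mkContinuous_norm_le _ zero_le_one hbd)
  refine ⟨m, hnorm, ?_, fun g => Bidual.ext fun f => ?_⟩
  · have e1 : rePart (augmentation G) = 1 := lp.ext (funext fun x => by simp [augmentation])
    have e2 : rePart (Complex.I • augmentation G) = 0 :=
      lp.ext (funext fun x => by
        rw [rePart_apply, _root_.smul_apply, augmentation, EllOne.extend_single]
        simp)
    rw [hm, hr, hr, e1, e2, h1, map_zero]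
    simp
  · have e : ∀ f : StrongDual ℂ (EllOne G),
        r (dualMap (mulLeft (EllOne.single g 1)) f) = r f := fun f => by
      rw [hr, hr, ← hinv g⁻¹ (rePart f)]
      congr 1
      exact lp.ext (funext fun x => by simp [EllOne.single_mul_single])
    have e' : r (Complex.I • dualMap (mulLeft (EllOne.single g 1)) f) = r (Complex.I • f) :=
      e (Complex.I • f)
    rw [Bidual.map_apply, hm, hm, e, e']

end Translate

/-! ### Idempotents of an inverse semigroup commute -/

section InverseSemigroup

variable {S : Type*} [Semigroup S] [IsInverseSemigroup S]

theorem semiInv_of_idempotent {e : S} (he : e * e = e) : semiInv e = e :=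
  (eq_semiInv (by rw [he, he]) (by rw [he, he])).symm

theorem idempotent_mul_semiInv (s : S) : (s * semiInv s) * (s * semiInv s) = s * semiInv s := by
  rw [← mul_assoc, mul_semiInv_mul]

theorem idempotent_semiInv_mul (s : S) : (semiInv s * s) * (semiInv s * s) = semiInv s * s := by
  rw [← mul_assoc, semiInv_mul_semiInv]

/-- Products of idempotents of an inverse semigroup are idempotent. -/
theorem idempotent_mul_idempotent {e f : S} (he : e * e = e) (hf : f * f = f) :
    (e * f) * (e * f) = e * f := by
  set x := semiInv (e * f) with hx
  have a1 : e * f * x * (e * f) = e * f := mul_semiInv_mul _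
  have a2 : x * (e * f) * x = x := semiInv_mul_semiInv _
  -- Besides `x`, also `f x e` is an inverse of `e f`, so they agree by uniqueness. This makes `x`
  -- idempotent, hence its own inverse, hence equal to `e f`.
  have h1 : (e * f) * (f * x * e) * (e * f) = e * f := by
    have : (e * f) * (f * x * e) * (e * f) = e * (f * f) * x * ((e * e) * f) := by
      simp only [mul_assoc]
    rw [this, hf, he, a1]
  have h2 : (f * x * e) * (e * f) * (f * x * e) = f * x * e := by
    have : (f * x * e) * (e * f) * (f * x * e) = f * (x * ((e * e) * (f * f)) * x) * e := by
      simp only [mul_assoc]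
    rw [this, hf, he, a2]
  have h3 : f * x * e = x := eq_semiInv h1 h2
  have h4 : x * x = x := by
    have : (f * x * e) * (f * x * e) = f * (x * (e * f) * x) * e := by simp only [mul_assoc]
    rw [a2, h3] at this
    exact this
  have h5 : e * f = x := by
    have : e * f = semiInv x := eq_semiInv a2 a1
    rw [this, semiInv_of_idempotent h4]
  rw [h5, h4]

/-- Idempotents of an inverse semigroup commute. -/
theorem idempotent_comm {e f : S} (he : e * e = e) (hf : f * f = f) : e * f = f * e := by
  have h1 := idempotent_mul_idempotent he hf
  have h2 := idempotent_mul_idempotent hf he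
  -- Both `e f` and `f e` are inverses of the idempotent `e f`.
  have h3 : f * e = semiInv (e * f) := by
    apply eq_semiInv
    · have : e * f * (f * e) * (e * f) = e * (f * f) * ((e * e) * f) := by simp only [mul_assoc]
      rw [this, hf, he, h1]
    · have : f * e * (e * f) * (f * e) = f * (e * e) * ((f * f) * e) := by simp only [mul_assoc]
      rw [this, hf, he, h2]
  rw [h3, semiInv_of_idempotent h1]

end InverseSemigroup

/-! ### Clifford semigroups as semilattices of groups -/

section Clifford

variable {S : Type*} [Semigroup S] [IsCliffordSemigroup S]

/-- Idempotents of a Clifford semigroup are central. -/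
theorem idempotent_central {e : S} (he : e * e = e) (s : S) : s * e = e * s := by
  have c1 : ∀ s : S, e * (semiInv s * s) = (semiInv s * s) * e := fun s =>
    idempotent_comm he (idempotent_semiInv_mul s)
  -- Knowing `(se)* = e s*`, the Clifford identity for `se` reads `s e s* = e s* s`; multiplying by
  -- `s` on the right yields `se = es`.
  have hinv : e * semiInv s = semiInv (s * e) := by
    apply eq_semiInv
    · have : s * e * (e * semiInv s) * (s * e) = s * (e * e) * (semiInv s * s) * e := by
        simp only [mul_assoc]
      rw [this, he, mul_assoc s, c1, ← mul_assoc s, ← mul_assoc s, mul_semiInv_mul, mul_assoc, he]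
    · have : e * semiInv s * (s * e) * (e * semiInv s) =
          e * ((semiInv s * s) * (e * e)) * semiInv s := by simp only [mul_assoc]
      rw [this, he, ← c1, ← mul_assoc, he, mul_assoc, semiInv_mul_semiInv]
  have h := IsCliffordSemigroup.mul_semiInv_comm (s * e)
  rw [← hinv] at h
  have h2 : s * e * (e * semiInv s) = s * e * semiInv s := by
    rw [mul_assoc s e (e * semiInv s), ← mul_assoc e e, he, ← mul_assoc]
  have h3 : e * semiInv s * (s * e) = e * (semiInv s * s) := by
    have : e * semiInv s * (s * e) = e * ((semiInv s * s) * e) := by simp only [mul_assoc]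
    rw [this, ← c1, ← mul_assoc, he]
  rw [h2, h3] at h
  have h4 := congrArg (· * s) h
  beta_reduce at h4
  have h5 : s * e * semiInv s * s = s * e := by
    rw [mul_assoc (s * e), mul_assoc s e, c1, ← mul_assoc, ← mul_assoc, mul_semiInv_mul]
  rw [h5] at h4
  rw [h4, mul_assoc, ← IsCliffordSemigroup.mul_semiInv_comm, mul_semiInv_mul]

/-- The idempotent `s s*` below which `s` lives. -/
noncomputable def dom (s : S) : Idempotents S := ⟨s * semiInv s, idempotent_mul_semiInv s⟩

theorem dom_mul_self (s : S) : (dom s).1 * s = s := mul_semiInv_mul s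

theorem self_mul_dom (s : S) : s * (dom s).1 = s := by
  rw [idempotent_central (dom s).2 s, dom_mul_self]

theorem dom_idem (e : Idempotents S) : dom e.1 = e :=
  Subtype.ext (by change e.1 * semiInv e.1 = e.1; rw [semiInv_of_idempotent e.2, e.2])

instance : CommSemigroup (Idempotents S) where
  mul e f := ⟨e.1 * f.1, idempotent_mul_idempotent e.2 f.2⟩
  mul_assoc _ _ _ := Subtype.ext (mul_assoc _ _ _)
  mul_comm e f := Subtype.ext (idempotent_comm e.2 f.2)

theorem Idempotents.coe_mul (e f : Idempotents S) : (e * f).1 = e.1 * f.1 := rfl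

theorem Idempotents.mul_self (e : Idempotents S) : e * e = e := Subtype.ext e.2

theorem semiInv_mul (s t : S) : semiInv (s * t) = semiInv t * semiInv s := by
  refine (eq_semiInv ?_ ?_).symm
  · have : s * t * (semiInv t * semiInv s) * (s * t) =
        s * (dom t).1 * (semiInv s * s) * t := by simp only [dom, mul_assoc]
    rw [this, idempotent_central (dom t).2, mul_assoc (dom t).1, ← mul_assoc s, mul_semiInv_mul,
      ← idempotent_central (dom t).2, mul_assoc, dom_mul_self]
  · have : semiInv t * semiInv s * (s * t) * (semiInv t * semiInv s) =
        semiInv t * (semiInv s * s) * (dom t).1 * semiInv s := by simp only [dom, mul_assoc]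
    rw [this, ← IsCliffordSemigroup.mul_semiInv_comm s]
    change semiInv t * (dom s).1 * (dom t).1 * semiInv s = _
    rw [idempotent_central (dom s).2, mul_assoc (dom s).1]
    have h1 : semiInv t * (dom t).1 = semiInv t := by
      rw [dom, ← mul_assoc, semiInv_mul_semiInv]
    have h2 : (dom s).1 * semiInv s = semiInv s := by
      rw [dom]
      change s * semiInv s * semiInv s = _
      rw [IsCliffordSemigroup.mul_semiInv_comm, semiInv_mul_semiInv]
    rw [h1, ← idempotent_central (dom s).2, mul_assoc, h2]

/-- Centrality of idempotents makes `s ↦ ss*` a homomorphism onto the semilattice `E(S)`. -/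
theorem dom_mul (s t : S) : dom (s * t) = dom s * dom t := by
  refine Subtype.ext ?_
  change s * t * semiInv (s * t) = s * semiInv s * (t * semiInv t)
  have : s * t * (semiInv t * semiInv s) = s * (dom t).1 * semiInv s := by
    simp only [dom, mul_assoc]
  rw [semiInv_mul, this, idempotent_central (dom t).2, mul_assoc,
    ← idempotent_central (dom t).2]
  rfl

/-- The natural order of the idempotents. -/
instance : PartialOrder (Idempotents S) where
  le e f := e * f = e
  le_refl e := e.mul_self
  le_trans e f g h1 h2 := by
    rw [← h1, mul_assoc, show f * g = f from h2]
  le_antisymm e f h1 h2 := by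
    rw [← show e * f = e from h1, mul_comm]
    exact h2

theorem Idempotents.le_def {e f : Idempotents S} : e ≤ f ↔ e * f = e := Iff.rfl

theorem Idempotents.mul_le_left (e f : Idempotents S) : e * f ≤ e := by
  rw [Idempotents.le_def, mul_right_comm, Idempotents.mul_self]

theorem Idempotents.mul_le_right (e f : Idempotents S) : e * f ≤ f := by
  rw [Idempotents.le_def, mul_assoc, Idempotents.mul_self]

theorem Idempotents.le_mul_iff {e f g : Idempotents S} : e ≤ f * g ↔ e ≤ f ∧ e ≤ g :=
  ⟨fun h => ⟨h.trans (mul_le_left f g), h.trans (mul_le_right f g)⟩, fun h => by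
    rw [le_def, ← mul_assoc, le_def.1 h.1, le_def.1 h.2]⟩

/-- The elements living above `e` form a subsemigroup whose complement is an ideal. This makes its
indicator function multiplicative. -/
theorem le_dom_mul_iff {e : Idempotents S} {s t : S} :
    e ≤ dom (s * t) ↔ e ≤ dom s ∧ e ≤ dom t := by
  rw [dom_mul, Idempotents.le_mul_iff]

theorem naturalLE_iff {e f : Idempotents S} : NaturalLE e.1 f.1 ↔ e ≤ f := by
  rw [NaturalLE, MaximalSubgroup.semiInv_idem, e.2, Idempotents.le_def, eq_comm]
  exact ⟨fun h => Subtype.ext h, fun h => congrArg Subtype.val h⟩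

theorem mem_maximalSubgroup {e : Idempotents S} {s : S} (h : dom s = e) :
    s * semiInv s = e.1 ∧ semiInv s * s = e.1 := by
  rw [← IsCliffordSemigroup.mul_semiInv_comm, ← h]
  exact ⟨rfl, rfl⟩

namespace MaximalSubgroup

variable {e : Idempotents S}

theorem dom_val (g : MaximalSubgroup e) : dom g.1 = e := Subtype.ext g.2.1

theorem coe_mul (g h : MaximalSubgroup e) : (g * h).1 = g.1 * h.1 := rfl

theorem coe_one : (1 : MaximalSubgroup e).1 = e.1 := rfl

/-- The element `e s` of `G_e`, for `e ≤ s s*`. -/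
def ofLE (s : S) (h : e ≤ dom s) : MaximalSubgroup e :=
  ⟨e.1 * s, mem_maximalSubgroup (by rw [dom_mul, dom_idem]; exact h)⟩

/-- Since `e` is central and idempotent, `s ↦ es` is a homomorphism into `G_e` on the elements above
`e`. -/
theorem ofLE_mul {s t : S} (hs : e ≤ dom s) (ht : e ≤ dom t) (h : e ≤ dom (s * t)) :
    ofLE (s * t) h = ofLE s hs * ofLE t ht := Subtype.ext <| by
  change e.1 * (s * t) = (e.1 * s) * (e.1 * t)
  rw [mul_assoc e.1 s, ← mul_assoc s e.1 t, idempotent_central e.2, mul_assoc e.1 s t,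
    ← mul_assoc e.1 e.1, e.2]

theorem ofLE_val (g : MaximalSubgroup e) (h : e ≤ dom g.1) : ofLE g.1 h = g :=
  Subtype.ext (left_id g)

end MaximalSubgroup

end Clifford

section Single

variable {S : Type*} [Semigroup S]

theorem EllOne.one_mul_single (s t : S) :
    EllOne.single s 1 * EllOne.single t 1 = EllOne.single (s * t) 1 := by
  rw [EllOne.single_mul_single, one_mul]

/-- A bounded functional on `ℓ¹(S)` that is multiplicative on `S` is multiplicative. -/
theorem EllOne.map_mul_of_single (f : StrongDual ℂ (EllOne S))
    (h : ∀ s t : S, f (single (s * t) 1) = f (single s 1) * f (single t 1)) (a b : EllOne S) :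
    f (a * b) = f a * f b := by
  have h1 : ∀ s b, f (single s 1 * b) = f (single s 1) * f b := fun s b =>
    DFunLike.congr_fun (hom_ext_one (T := f.comp (mulLeft (single s 1)))
      (U := f (single s 1) • f) fun t => by
        simp only [ContinuousLinearMap.comp_apply, ContinuousLinearMap.mul_apply', one_mul_single,
          _root_.smul_apply, smul_eq_mul, h]) b
  refine (DFunLike.congr_fun (hom_ext_one
    (T := f.comp ((ContinuousLinearMap.mul ℂ (EllOne S)).flip b))
    (U := f b • f) fun t => by
      simp only [ContinuousLinearMap.comp_apply, ContinuousLinearMap.flip_apply,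
        ContinuousLinearMap.mul_apply', _root_.smul_apply, smul_eq_mul, h1, mul_comm]) a).trans
    (mul_comm _ _)

end Single

variable {S : Type*} [Semigroup S] [IsCliffordSemigroup S]

open EllOne

/-! ### From local means to amenability of the maximal subgroups -/

section LocalCharacter

open Classical in
/-- The character of `ℓ¹(S)` with `δ_s ↦ 1` if `e ≤ s s*`, and `δ_s ↦ 0` otherwise. -/
noncomputable def filterFunctional (e : Idempotents S) : StrongDual ℂ (EllOne S) :=
  extend (fun s => if e ≤ dom s then 1 else 0) 1 fun s => by split_ifs <;> simp

open Classical in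
theorem filterFunctional_single (e : Idempotents S) (s : S) :
    filterFunctional e (single s 1) = if e ≤ dom s then 1 else 0 := extend_single _ _ _ s

theorem filterFunctional_self (e : Idempotents S) : filterFunctional e (single e.1 1) = 1 := by
  rw [filterFunctional_single, dom_idem, if_pos le_rfl]

theorem filterFunctional_mul (e : Idempotents S) (a b : EllOne S) :
    filterFunctional e (a * b) = filterFunctional e a * filterFunctional e b :=
  map_mul_of_single _ (fun s t => by
    simp only [filterFunctional_single]
    by_cases h1 : e ≤ dom s <;> by_cases h2 : e ≤ dom t <;> simp [le_dom_mul_iff, h1, h2]) a b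

/-- The character of `ℓ¹(S)` given by the filter of idempotents above `e`. -/
noncomputable def filterCharacter (e : Idempotents S) : WeakDual.characterSpace ℂ (EllOne S) :=
  ⟨StrongDual.toWeakDual (filterFunctional e), fun h => by
      have := DFunLike.congr_fun h (single e.1 1)
      exact one_ne_zero ((filterFunctional_self e).symm.trans this),
    filterFunctional_mul e⟩

theorem charDual_filterCharacter (e : Idempotents S) :
    charDual (filterCharacter e) = filterFunctional e := rfl

open Classical in
/-- The operator `ℓ¹(S) → ℓ¹(G_e)` with `δ_s ↦ δ_{es}` if `e ≤ s s*`, and `δ_s ↦ 0` otherwise. -/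
noncomputable def toSubgroup (e : Idempotents S) : EllOne S →L[ℂ] EllOne (MaximalSubgroup e) :=
  extend (fun s => if h : e ≤ dom s then single (MaximalSubgroup.ofLE s h) 1 else 0) 1 fun s => by
    split_ifs <;> simp [norm_single]

open Classical in
theorem toSubgroup_single (e : Idempotents S) (s : S) : toSubgroup e (single s 1) =
    if h : e ≤ dom s then single (MaximalSubgroup.ofLE s h) 1 else 0 := extend_single _ _ _ s

/-- Left multiplication by `g ∈ G_e` preserves whether an element lies above `e`, so compression to
`G_e` intertwines the two left actions. -/
theorem toSubgroup_comp_mulLeft {e : Idempotents S} (g : MaximalSubgroup e) :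
    (toSubgroup e).comp (mulLeft (single g.1 1)) = (mulLeft (single g 1)).comp (toSubgroup e) := by
  refine hom_ext_one fun s => ?_
  simp only [ContinuousLinearMap.comp_apply, ContinuousLinearMap.mul_apply', one_mul_single,
    toSubgroup_single]
  have hg : e ≤ dom g.1 := g.dom_val.ge
  by_cases hs : e ≤ dom s
  · have h : e ≤ dom (g.1 * s) := le_dom_mul_iff.2 ⟨hg, hs⟩
    rw [dif_pos h, dif_pos hs, MaximalSubgroup.ofLE_mul hg hs h, MaximalSubgroup.ofLE_val,
      one_mul_single]
  · have h : ¬ e ≤ dom (g.1 * s) := fun h => hs (le_dom_mul_iff.1 h).2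
    rw [dif_neg h, dif_neg hs, mul_zero]

/-- The augmentation of `ℓ¹(G_e)` pulls back to the filter character. That character is 1 on `G_e`,
whose elements commute with `e`, so the compressed local mean is invariant. -/
theorem isAmenableGroup_of_hasLocalMean (e : Idempotents S)
    (h : HasLocalMean (filterCharacter e) (single e.1 1)) :
    IsAmenableGroup (MaximalSubgroup e) := by
  obtain ⟨n, h1, hn⟩ := h
  rw [charDual_filterCharacter] at h1 hn
  refine isAmenableGroup_of_bidual (Bidual.map (toSubgroup e) n) ?_ fun g => ?_
  · have : dualMap (toSubgroup e) (augmentation _) = filterFunctional e :=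
      hom_ext_one fun s => by
        rw [dualMap_apply, toSubgroup_single, filterFunctional_single]
        by_cases hs : e ≤ dom s <;> simp [hs, augmentation]
    rw [Bidual.map_apply, this, h1, filterFunctional_self]
  · rw [Bidual.map_comp, ← toSubgroup_comp_mulLeft, ← Bidual.map_comp, hn, filterFunctional_single,
      if_pos g.dom_val.ge, one_smul]
    rw [one_mul_single, one_mul_single, g.left_id, g.right_id]

end LocalCharacter

/-! ### Möbius inversion over the semilattice of idempotents -/

section Primitive

open Finset

variable [LocallyFiniteOrderBot (Idempotents S)]

theorem card_Iic_lt {e f : Idempotents S} (h : f < e) : #(Iic f) < #(Iic e) :=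
  card_lt_card (Iic_ssubset_Iic.2 h)

instance : WellFoundedLT (Idempotents S) :=
  ⟨Subrelation.wf (fun h => card_Iic_lt h)
    (InvImage.wf (fun e : Idempotents S => #(Iic e)) Nat.lt_wfRel.wf)⟩

/-- The Möbius inversion `u_e = δ_e - ∑_{f < e} u_f` of the idempotents: the unit of the summand
of `ℓ¹(S)` isomorphic to `ℓ¹(G_e)`. -/
noncomputable def primitive (e : Idempotents S) : EllOne S :=
  single e.1 1 - ∑ f ∈ (Iio e).attach, primitive f.1
termination_by #(Iic e)
decreasing_by exact card_Iic_lt (mem_Iio.1 f.2)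

theorem primitive_eq (e : Idempotents S) :
    primitive e = single e.1 1 - ∑ f ∈ Iio e, primitive f := by
  rw [primitive, sum_attach]

theorem sum_primitive (e : Idempotents S) : ∑ f ∈ Iic e, primitive f = single e.1 1 := by
  classical
  rw [← Iio_insert, sum_insert (by simp), primitive_eq e, sub_add_cancel]

theorem single_idem_mul_primitive [DecidableLE (Idempotents S)] (k e : Idempotents S) :
    single k.1 1 * primitive e = if e ≤ k then primitive e else 0 := by
  induction e using WellFoundedLT.induction with
  | ind e ih =>
    rw [primitive_eq e, mul_sub, mul_sum, one_mul_single, ← Idempotents.coe_mul,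
      sum_congr rfl fun f hf => ih f (mem_Iio.1 hf)]
    by_cases h : e ≤ k
    · rw [if_pos h, mul_comm, Idempotents.le_def.1 h]
      congr 1
      exact sum_congr rfl fun f hf => if_pos ((mem_Iio.1 hf).le.trans h)
    -- If `e ≰ k`, the surviving `f < e` with `f ≤ k` are exactly the `f ≤ ke`, and their `u_f` add
    -- up to `δ_{ke}`.
    · rw [if_neg h, ← sum_filter, ← sum_primitive, sub_eq_zero]
      refine sum_congr (Finset.ext fun f => ?_) fun _ _ => rfl
      rw [mem_filter, mem_Iio, mem_Iic, Idempotents.le_mul_iff]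
      exact ⟨fun hf => ⟨lt_of_le_of_ne hf.2 fun he => h (he ▸ hf.1), hf.1⟩,
        fun hf => ⟨hf.2, hf.1.le⟩⟩

theorem single_mul_primitive_of_le {k e : Idempotents S} (h : e ≤ k) :
    single k.1 1 * primitive e = primitive e := by
  classical
  rw [single_idem_mul_primitive, if_pos h]

theorem single_mul_primitive_of_not_le {s : S} {e : Idempotents S} (h : ¬ e ≤ dom s) :
    single s 1 * primitive e = 0 := by
  classical
  rw [← self_mul_dom s, ← one_mul_single, mul_assoc, single_idem_mul_primitive, if_neg h, mul_zero]

theorem single_mul_primitive_comm (s : S) (e : Idempotents S) :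
    single s 1 * primitive e = primitive e * single s 1 := by
  induction e using WellFoundedLT.induction with
  | ind e ih =>
    rw [primitive_eq e, mul_sub, sub_mul, mul_sum, sum_mul, one_mul_single, one_mul_single,
      idempotent_central e.2, sum_congr rfl fun f hf => ih f (mem_Iio.1 hf)]

theorem primitive_mul_self (e : Idempotents S) : primitive e * primitive e = primitive e := by
  -- For `f < e` one has `u_f = u_f δ_f`, and `δ_f` annihilates `u_e` because `e ≰ f`.
  have h : ∀ f ∈ Iio e, primitive f * primitive e = 0 := fun f hf => by
    rw [← single_mul_primitive_of_le le_rfl, single_mul_primitive_comm, mul_assoc,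
      single_mul_primitive_of_not_le, mul_zero]
    rw [dom_idem]
    exact not_le_of_gt (mem_Iio.1 hf)
  nth_rewrite 1 [primitive_eq e]
  rw [sub_mul, single_mul_primitive_of_le le_rfl, sum_mul, sum_eq_zero h, sub_zero]

theorem norm_primitive_le {N : ℕ} (hN : ∀ e : Idempotents S, #(Iic e) ≤ N) (e : Idempotents S) :
    ‖primitive e‖ ≤ (N + 1 : ℝ) ^ N := by
  have h1 : (1 : ℝ) ≤ N + 1 := by linarith [Nat.cast_nonneg (α := ℝ) N]
  -- The induction is on the size `n + 1` of the lower set of `e`; it closes because `1 + N (N+1)^n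
  -- ≤ (N+1)^(n+1)`.
  have key : ‖primitive e‖ ≤ (N + 1 : ℝ) ^ #(Iic e) := by
    induction e using WellFoundedLT.induction with
    | ind e ih =>
      have hpos : 0 < #(Iic e) := card_pos.2 ⟨e, mem_Iic.2 le_rfl⟩
      obtain ⟨n, hn⟩ := Nat.exists_eq_succ_of_ne_zero hpos.ne'
      have hsum : ‖∑ f ∈ Iio e, primitive f‖ ≤ N * (N + 1 : ℝ) ^ n := by
        refine (norm_sum_le _ _).trans ((sum_le_sum (g := fun _ => (N + 1 : ℝ) ^ n)
          fun f hf => ?_).trans ?_)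
        · refine (ih f (mem_Iio.1 hf)).trans (pow_le_pow_right₀ h1 ?_)
          have := card_Iic_lt (mem_Iio.1 hf)
          omega
        · rw [sum_const, nsmul_eq_mul]
          gcongr
          exact (card_le_card Iio_subset_Iic_self).trans (hN e)
      rw [primitive_eq e]
      refine (norm_sub_le _ _).trans ?_
      rw [norm_single, norm_one, hn, pow_succ]
      have : (1 : ℝ) ≤ (N + 1 : ℝ) ^ n := one_le_pow₀ h1
      linarith
  exact key.trans (pow_le_pow_right₀ h1 (hN e))

end Primitive

/-- Uniformly locally finite idempotents have finite lower sets of bounded size. -/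
theorem exists_locallyFiniteOrderBot (hE : IdempotentsUniformlyLocallyFinite S) :
    ∃ (_ : LocallyFiniteOrderBot (Idempotents S)) (N : ℕ),
      ∀ e : Idempotents S, (Finset.Iic e).card ≤ N := by
  classical
  obtain ⟨N, hN⟩ := hE
  have hset : ∀ e : Idempotents S, {f : Idempotents S | NaturalLE f.1 e.1} = Set.Iic e := fun e =>
    Set.ext fun f => naturalLE_iff
  simp only [hset] at hN
  have hfin : ∀ e : Idempotents S, (Set.Iic e).Finite := fun e =>
    Set.encard_lt_top_iff.1 ((hN e).trans_lt (ENat.natCast_lt_top N))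
  let inst : LocallyFiniteOrderBot (Idempotents S) :=
    LocallyFiniteOrderBot.ofIic (Idempotents S) (fun e => (hfin e).toFinset) fun e f => by simp
  refine ⟨inst, N, fun e => ?_⟩
  have := hN e
  rw [← Finset.coe_Iic, Set.encard_coe_eq_coe_finsetCard] at this
  exact_mod_cast this

/-! ### Norm bounds and linearity of second adjoints -/

section Norms

variable {E F G : Type*} [NormedAddCommGroup E] [NormedSpace ℂ E]
  [NormedAddCommGroup F] [NormedSpace ℂ F] [NormedAddCommGroup G] [NormedSpace ℂ G]

theorem Bidual.map_add_left (T U : E →L[ℂ] F) (m : Bidual E) :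
    Bidual.map (T + U) m = Bidual.map T m + Bidual.map U m := by
  refine Bidual.ext fun f => ?_
  have : dualMap (T + U) f = dualMap T f + dualMap U f := by ext x; simp
  rw [Bidual.map_apply, this, map_add]
  rfl

theorem Bidual.map_zero_left (m : Bidual E) : Bidual.map (0 : E →L[ℂ] F) m = 0 := by
  have := Bidual.map_smul_left (0 : ℂ) (0 : E →L[ℂ] F) m
  rwa [zero_smul, zero_smul] at this

theorem Bidual.norm_map_le (T : E →L[ℂ] F) (m : Bidual E) : ‖Bidual.map T m‖ ≤ ‖T‖ * ‖m‖ := by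
  refine ContinuousLinearMap.opNorm_le_bound (Bidual.toDual (Bidual.map T m)) (by positivity)
    fun f => ?_
  calc ‖Bidual.toDual m (dualMap T f)‖ ≤ ‖Bidual.toDual m‖ * ‖dualMap T f‖ :=
        (Bidual.toDual m).le_opNorm _
    _ ≤ ‖m‖ * (‖f‖ * ‖T‖) := by
      gcongr
      · exact le_of_eq (Bidual.toDual.norm_map m)
      · exact f.opNorm_comp_le T
    _ = _ := by ring

/-- The second adjoint of a linear family of operators, applied to a fixed functional. -/
noncomputable def Bidual.mapApply (Λ : G →L[ℂ] E →L[ℂ] F) (m : Bidual E) : G →L[ℂ] Bidual F :=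
  LinearMap.mkContinuous
    { toFun := fun a => Bidual.map (Λ a) m
      map_add' := fun a b => by rw [map_add, Bidual.map_add_left]
      map_smul' := fun c a => by rw [map_smul, Bidual.map_smul_left]; rfl }
    (‖Λ‖ * ‖m‖) fun a => by
      refine (Bidual.norm_map_le (Λ a) m).trans ?_
      rw [mul_right_comm]
      gcongr
      exact Λ.le_opNorm a

theorem ProjTensor.norm_lift_le [CompleteSpace G] (B : E →L[ℂ] F →L[ℂ] G) :
    ‖ProjTensor.lift B‖ ≤ ‖B‖ := by
  refine ContinuousLinearMap.opNorm_le_bound _ (norm_nonneg B) fun u => ?_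
  induction u using UniformSpace.Completion.induction_on with
  | hp => exact isClosed_le (ProjTensor.lift B).continuous.norm (by fun_prop)
  | ih u =>
    have h1 : ProjTensor.lift B (u : ProjTensor E F) = AlgTensor.lift B u := by
      simp [ProjTensor.lift]
    rw [h1, UniformSpace.Completion.norm_coe]
    exact (AlgTensor.lift B).le_of_opNorm_le (LinearMap.mkContinuous_norm_le _ (norm_nonneg B) _) u

theorem ProjTensor.norm_tmul_le (x : E) (y : F) :
    ‖(ProjTensor.tmul x y : ProjTensor E F)‖ ≤ ‖x‖ * ‖y‖ :=
  (UniformSpace.Completion.norm_coe _).le.trans (AlgTensor.norm_mk_le x y)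

theorem ProjTensor.norm_tmul_left_le (x : E) :
    ‖(ProjTensor.tmul x : F →L[ℂ] ProjTensor E F)‖ ≤ ‖x‖ :=
  ContinuousLinearMap.opNorm_le_bound _ (norm_nonneg _) fun y => norm_tmul_le x y

end Norms

/-! ### The module actions on `A ⊗_p A` and its second dual -/

section Actions

variable {A : Type*} [NonUnitalNormedRing A] [NormedSpace ℂ A] [IsScalarTower ℂ A A]
  [SMulCommClass ℂ A A]

theorem norm_leftAct_le (a : A) : ‖leftAct a‖ ≤ ‖a‖ := by
  refine (ProjTensor.norm_lift_le _).trans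
    (ContinuousLinearMap.opNorm_le_bound _ (norm_nonneg _) fun b => ?_)
  exact (ProjTensor.norm_tmul_left_le _).trans (norm_mul_le a b)

theorem norm_rightAct_le (a : A) : ‖rightAct a‖ ≤ ‖a‖ := by
  refine (ProjTensor.norm_lift_le _).trans
    (ContinuousLinearMap.opNorm_le_bound₂ _ (norm_nonneg _) fun b c => ?_)
  refine (ProjTensor.norm_tmul_le b (c * a)).trans ?_
  calc ‖b‖ * ‖c * a‖ ≤ ‖b‖ * (‖c‖ * ‖a‖) := by gcongr; exact norm_mul_le c a
    _ = _ := by ring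

/-- The left action of `A` on `A ⊗_p A`, as a bounded map. -/
noncomputable def leftActL : A →L[ℂ] ProjTensor A A →L[ℂ] ProjTensor A A :=
  LinearMap.mkContinuous
    { toFun := leftAct
      map_add' := fun a b => ProjTensor.hom_ext fun x y => by simp [add_mul]
      map_smul' := fun c a => ProjTensor.hom_ext fun x y => by simp [smul_mul_assoc] }
    1 fun a => by rw [one_mul]; exact norm_leftAct_le a

/-- The right action of `A` on `A ⊗_p A`, as a bounded map. -/
noncomputable def rightActL : A →L[ℂ] ProjTensor A A →L[ℂ] ProjTensor A A :=
  LinearMap.mkContinuous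
    { toFun := rightAct
      map_add' := fun a b => ProjTensor.hom_ext fun x y => by simp [mul_add]
      map_smul' := fun c a => ProjTensor.hom_ext fun x y => by simp [mul_smul_comm] }
    1 fun a => by rw [one_mul]; exact norm_rightAct_le a

theorem leftAct_zero : leftAct (0 : A) = 0 := map_zero leftActL

theorem rightAct_zero : rightAct (0 : A) = 0 := map_zero rightActL

theorem leftAct_comp (a b : A) : (leftAct a).comp (leftAct b) = leftAct (a * b) :=
  ProjTensor.hom_ext fun x y => by simp [mul_assoc]

theorem rightAct_comp (a b : A) : (rightAct a).comp (rightAct b) = rightAct (b * a) :=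
  ProjTensor.hom_ext fun x y => by simp [mul_assoc]

theorem leftAct_comp_rightAct (a b : A) :
    (leftAct a).comp (rightAct b) = (rightAct b).comp (leftAct a) :=
  ProjTensor.hom_ext fun x y => by simp

theorem prodMap_comp_leftAct [CompleteSpace A] (a : A) :
    (prodMap A).comp (leftAct a) = (mulLeft a).comp (prodMap A) :=
  ProjTensor.hom_ext fun x y => by simp [mul_assoc]

theorem bidualLeftAct_eq (a : A) : bidualLeftAct a = Bidual.map (leftAct a) := rfl

theorem bidualRightAct_eq (a : A) : bidualRightAct a = Bidual.map (rightAct a) := rfl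

theorem bidualLeftAct_map {E : Type*} [NormedAddCommGroup E] [NormedSpace ℂ E] (a : A)
    (T : E →L[ℂ] ProjTensor A A) (m : Bidual E) :
    bidualLeftAct a (Bidual.map T m) = Bidual.map ((leftAct a).comp T) m := by
  rw [bidualLeftAct_eq, Bidual.map_comp]

theorem bidualRightAct_map {E : Type*} [NormedAddCommGroup E] [NormedSpace ℂ E] (a : A)
    (T : E →L[ℂ] ProjTensor A A) (m : Bidual E) :
    bidualRightAct a (Bidual.map T m) = Bidual.map ((rightAct a).comp T) m := by
  rw [bidualRightAct_eq, Bidual.map_comp]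

theorem bidualLeftAct_bidualLeftAct (a b : A) (X : Bidual (ProjTensor A A)) :
    bidualLeftAct a (bidualLeftAct b X) = bidualLeftAct (a * b) X := by
  rw [bidualLeftAct_eq, bidualLeftAct_eq, bidualLeftAct_eq, Bidual.map_comp, leftAct_comp]

theorem bidualRightAct_bidualLeftAct (a b : A) (X : Bidual (ProjTensor A A)) :
    bidualRightAct a (bidualLeftAct b X) = bidualLeftAct b (bidualRightAct a X) := by
  rw [bidualLeftAct_eq, bidualRightAct_eq, Bidual.map_comp, Bidual.map_comp,
    leftAct_comp_rightAct]

theorem map_prodMap_bidualLeftAct [CompleteSpace A] (a : A) (X : Bidual (ProjTensor A A)) :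
    Bidual.map (prodMap A) (bidualLeftAct a X) =
      Bidual.map (mulLeft a) (Bidual.map (prodMap A) X) := by
  rw [bidualLeftAct_eq, Bidual.map_comp, Bidual.map_comp, prodMap_comp_leftAct]

/-- The left action on a fixed element of `(A ⊗_p A)**`, as a bounded map. -/
noncomputable def bidualLeftActL (X : Bidual (ProjTensor A A)) :
    A →L[ℂ] Bidual (ProjTensor A A) := Bidual.mapApply leftActL X

theorem bidualLeftActL_apply (X : Bidual (ProjTensor A A)) (a : A) :
    bidualLeftActL X a = bidualLeftAct a X := rfl

/-- The right action on a fixed element of `(A ⊗_p A)**`, as a bounded map. -/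
noncomputable def bidualRightActL (X : Bidual (ProjTensor A A)) :
    A →L[ℂ] Bidual (ProjTensor A A) := Bidual.mapApply rightActL X

theorem bidualRightActL_apply (X : Bidual (ProjTensor A A)) (a : A) :
    bidualRightActL X a = bidualRightAct a X := rfl

end Actions

/-! ### A splitting assembled from a family of commuting elements -/

section Diagonal

open EllOne

theorem EllOne.eq_of_single {S X : Type*} [Semigroup S] [NormedAddCommGroup X] [NormedSpace ℂ X]
    {T U : EllOne S →L[ℂ] X} (h : ∀ s, T (single s 1) = U (single s 1)) (a : EllOne S) :
    T a = U a := by rw [hom_ext_one h]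

/-- Density of point masses is used once in each variable. The auxiliary `L'` supplies the bounded
linear dependence of `L a x` on `a`, which a bare family of operators does not carry. -/
theorem EllOne.map_mul_left_of_single {S X : Type*} [Semigroup S] [NormedAddCommGroup X]
    [NormedSpace ℂ X] (ρ : EllOne S →L[ℂ] X) (L : EllOne S → X →L[ℂ] X)
    (L' : X → EllOne S →L[ℂ] X) (hL : ∀ x a, L' x a = L a x)
    (h : ∀ s t, ρ (single s 1 * single t 1) = L (single s 1) (ρ (single t 1)))
    (a b : EllOne S) : ρ (a * b) = L a (ρ b) := by
  have h1 : ∀ s b, ρ (single s 1 * b) = L (single s 1) (ρ b) := fun s =>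
    eq_of_single (T := ρ.comp (mulLeft (single s 1))) (U := (L (single s 1)).comp ρ) fun t => h s t
  rw [← hL]
  exact eq_of_single (T := ρ.comp ((ContinuousLinearMap.mul ℂ (EllOne S)).flip b)) (U := L' (ρ b))
    (fun s => (h1 s b).trans (hL _ _).symm) a

theorem EllOne.map_mul_right_of_single {S X : Type*} [Semigroup S] [NormedAddCommGroup X]
    [NormedSpace ℂ X] (ρ : EllOne S →L[ℂ] X) (R : EllOne S → X →L[ℂ] X)
    (R' : X → EllOne S →L[ℂ] X) (hR : ∀ x a, R' x a = R a x)
    (h : ∀ s t, ρ (single s 1 * single t 1) = R (single t 1) (ρ (single s 1)))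
    (a b : EllOne S) : ρ (a * b) = R b (ρ a) := by
  have h1 : ∀ t a, ρ (a * single t 1) = R (single t 1) (ρ a) := fun t =>
    eq_of_single (T := ρ.comp ((ContinuousLinearMap.mul ℂ (EllOne S)).flip (single t 1)))
      (U := (R (single t 1)).comp ρ) fun s => h s t
  rw [← hR]
  exact eq_of_single (T := ρ.comp (mulLeft a)) (U := R' (ρ a))
    (fun t => (h1 t a).trans (hR _ _).symm) b

/-- A family `N_i` in `(A ⊗_p A)**`, `A = ℓ¹(S)`, which commutes with the actions, such that
`∑_{i ∈ I s} δ_s · N_i` is a splitting of the product morphism. -/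
theorem isBiflat_of_family {S ι : Type*} [Semigroup S]
    (N : ι → Bidual (ProjTensor (EllOne S) (EllOne S))) (I : S → Finset ι) (C : ℝ)
    (hbound : ∀ s, ‖∑ i ∈ I s, bidualLeftAct (single s 1) (N i)‖ ≤ C)
    (hI : ∀ s t, I (s * t) ⊆ I s ∧ I (s * t) ⊆ I t)
    (hzero : ∀ s i, i ∉ I s → bidualLeftAct (single s 1) (N i) = 0)
    (hcomm : ∀ s i, bidualLeftAct (single s 1) (N i) = bidualRightAct (single s 1) (N i))
    (hprod : ∀ s, ∑ i ∈ I s, Bidual.map (mulLeft (single s 1))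
      (Bidual.map (prodMap (EllOne S)) (N i)) = Bidual.incl _ (single s 1)) :
    IsBiflat (EllOne S) := by
  obtain ⟨ρ, hρ⟩ : ∃ ρ : EllOne S →L[ℂ] Bidual (ProjTensor (EllOne S) (EllOne S)),
      ∀ s, ρ (single s 1) = ∑ i ∈ I s, bidualLeftAct (single s 1) (N i) :=
    ⟨extend _ C hbound, fun s => extend_single _ _ _ s⟩
  refine ⟨ρ, map_mul_left_of_single ρ bidualLeftAct bidualLeftActL bidualLeftActL_apply
    fun s t => ?_, map_mul_right_of_single ρ bidualRightAct bidualRightActL bidualRightActL_apply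
    fun s t => ?_, eq_of_single (T := (Bidual.map (prodMap (EllOne S))).comp ρ) fun s => ?_⟩
  · rw [one_mul_single, hρ, hρ, map_sum, Finset.sum_congr rfl fun i _ =>
      (bidualLeftAct_bidualLeftAct _ _ (N i)).trans (by rw [one_mul_single])]
    -- Indices in `I t` outside `I (s * t)` contribute nothing, because `δ_{st}` kills their `N i`.
    exact Finset.sum_subset (hI s t).2 fun i _ hi => hzero _ i hi
  -- `(s · N_i) · t = s · (N_i · t) = s · (t · N_i) = (st) · N_i`.
  · have : ∀ i, bidualRightAct (single t 1) (bidualLeftAct (single s 1) (N i)) =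
        bidualLeftAct (single (s * t) 1) (N i) := fun i => by
      rw [bidualRightAct_bidualLeftAct, ← hcomm, bidualLeftAct_bidualLeftAct, one_mul_single]
    rw [one_mul_single, hρ, hρ, map_sum, Finset.sum_congr rfl fun i _ => this i]
    exact Finset.sum_subset (hI s t).1 fun i _ hi => hzero _ i hi
  · rw [ContinuousLinearMap.comp_apply, hρ, map_sum, ← hprod]
    exact Finset.sum_congr rfl fun i _ => map_prodMap_bidualLeftAct _ _

end Diagonal

/-! ### Virtual diagonals of the summands, and biflatness -/

section Biflat

open EllOne Finset

variable {S : Type*} [Semigroup S] [IsCliffordSemigroup S] {e : Idempotents S}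

/-- The operator `ℓ¹(G_e) → ℓ¹(S) ⊗_p ℓ¹(S)` with `δ_g ↦ δ_g ⊗ δ_{g⁻¹}`. -/
noncomputable def diagonal (e : Idempotents S) :
    EllOne (MaximalSubgroup e) →L[ℂ] ProjTensor (EllOne S) (EllOne S) :=
  extend (fun g => ProjTensor.tmul (single g.1 1) (single (g⁻¹).1 1)) 1 fun g => by
    refine (ProjTensor.norm_tmul_le _ _).trans ?_
    simp [norm_single]

theorem diagonal_single (g : MaximalSubgroup e) : diagonal e (single g 1) =
    ProjTensor.tmul (single g.1 1) (single (g⁻¹).1 1) := extend_single _ _ _ g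

/-- Change of variable in the group: `hg ⊗ g⁻¹ = hg ⊗ (hg)⁻¹ h`. -/
theorem leftAct_comp_diagonal (h : MaximalSubgroup e) :
    (leftAct (single h.1 1)).comp (diagonal e) =
      ((rightAct (single h.1 1)).comp (diagonal e)).comp (mulLeft (single h 1)) := by
  refine hom_ext_one fun g => ?_
  simp only [ContinuousLinearMap.comp_apply, ContinuousLinearMap.mul_apply', one_mul_single,
    diagonal_single, leftAct_tmul, rightAct_tmul]
  rw [← MaximalSubgroup.coe_mul, ← MaximalSubgroup.coe_mul]
  simp

variable [LocallyFiniteOrderBot (Idempotents S)]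

/-- The operator `ℓ¹(G_e) → ℓ¹(S) ⊗_p ℓ¹(S)` with `δ_g ↦ u_e δ_g ⊗ δ_{g⁻¹} u_e`. -/
noncomputable def primitiveDiagonal (e : Idempotents S) :
    EllOne (MaximalSubgroup e) →L[ℂ] ProjTensor (EllOne S) (EllOne S) :=
  (leftAct (primitive e)).comp ((rightAct (primitive e)).comp (diagonal e))

theorem norm_primitiveDiagonal_le (e : Idempotents S) :
    ‖primitiveDiagonal e‖ ≤ ‖primitive e‖ * ‖primitive e‖ := by
  have hd : ‖diagonal e‖ ≤ 1 := norm_extend_le _ _ zero_le_one _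
  calc ‖primitiveDiagonal e‖
      ≤ ‖leftAct (primitive e)‖ * ‖(rightAct (primitive e)).comp (diagonal e)‖ :=
        ContinuousLinearMap.opNorm_comp_le _ _
    _ ≤ ‖leftAct (primitive e)‖ * (‖rightAct (primitive e)‖ * ‖diagonal e‖) := by
      gcongr; exact ContinuousLinearMap.opNorm_comp_le _ _
    _ ≤ ‖primitive e‖ * (‖primitive e‖ * 1) := by
      gcongr
      · exact norm_leftAct_le _
      · exact norm_rightAct_le _
    _ = _ := by rw [mul_one]

theorem single_mul_primitive_eq {s : S} (h : e ≤ dom s) : single s 1 * primitive e =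
    single (MaximalSubgroup.ofLE s h).1 1 * primitive e := by
  change _ = single (e.1 * s) 1 * primitive e
  rw [← idempotent_central e.2, ← one_mul_single, mul_assoc, single_mul_primitive_of_le le_rfl]

theorem leftAct_comp_primitiveDiagonal_of_not_le {s : S} (h : ¬ e ≤ dom s) :
    (leftAct (single s 1)).comp (primitiveDiagonal e) = 0 := by
  rw [primitiveDiagonal, ← ContinuousLinearMap.comp_assoc, leftAct_comp,
    single_mul_primitive_of_not_le h, leftAct_zero, ContinuousLinearMap.zero_comp]

theorem rightAct_comp_primitiveDiagonal_of_not_le {s : S} (h : ¬ e ≤ dom s) :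
    (rightAct (single s 1)).comp (primitiveDiagonal e) = 0 := by
  rw [primitiveDiagonal, ← ContinuousLinearMap.comp_assoc, ← leftAct_comp_rightAct,
    ContinuousLinearMap.comp_assoc, ← ContinuousLinearMap.comp_assoc (rightAct _), rightAct_comp,
    ← single_mul_primitive_comm,
    single_mul_primitive_of_not_le h, rightAct_zero, ContinuousLinearMap.zero_comp,
    ContinuousLinearMap.comp_zero]

/-- Next to the central `u_e`, `s` may be replaced by `es ∈ G_e`, which reduces the claim to the
change of variable in `G_e`. An invariant functional then does not see the extra translation. -/
theorem leftAct_comp_primitiveDiagonal {s : S} (h : e ≤ dom s) :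
    (leftAct (single s 1)).comp (primitiveDiagonal e) =
      ((rightAct (single s 1)).comp (primitiveDiagonal e)).comp
        (mulLeft (single (MaximalSubgroup.ofLE s h) 1)) := by
  refine hom_ext_one fun g => ?_
  have h0 := DFunLike.congr_fun (leftAct_comp_diagonal (MaximalSubgroup.ofLE s h)) (single g 1)
  simp only [ContinuousLinearMap.comp_apply, ContinuousLinearMap.mul_apply', one_mul_single,
    diagonal_single, leftAct_tmul, rightAct_tmul, primitiveDiagonal] at h0 ⊢
  have h1 : single s 1 * (primitive e * single g.1 1) =
      primitive e * single ((MaximalSubgroup.ofLE s h).1 * g.1) 1 := by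
    rw [← mul_assoc, single_mul_primitive_eq h, single_mul_primitive_comm, mul_assoc,
      one_mul_single]
  have h2 : single ((MaximalSubgroup.ofLE s h * g)⁻¹).1 1 * primitive e * single s 1 =
      single (((MaximalSubgroup.ofLE s h * g)⁻¹).1 * (MaximalSubgroup.ofLE s h).1) 1 *
        primitive e := by
    rw [mul_assoc, ← single_mul_primitive_comm, single_mul_primitive_eq h, ← mul_assoc,
      one_mul_single]
  rw [h1, h2, ← MaximalSubgroup.coe_mul, ← MaximalSubgroup.coe_mul, mul_inv_rev, mul_assoc,
    inv_mul_cancel, mul_one]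

/-- Each `δ_g` goes to `u_e δ_g δ_{g⁻¹} u_e = u_e δ_e u_e = u_e`. -/
theorem prodMap_comp_primitiveDiagonal (e : Idempotents S) :
    (prodMap (EllOne S)).comp (primitiveDiagonal e) =
      (augmentation (MaximalSubgroup e)).smulRight (primitive e) := by
  refine hom_ext_one fun g => ?_
  simp only [ContinuousLinearMap.comp_apply, diagonal_single, leftAct_tmul, rightAct_tmul,
    primitiveDiagonal, prodMap_tmul, augmentation, ContinuousLinearMap.smulRight_apply,
    extend_single, one_smul]
  rw [mul_assoc, ← mul_assoc (single g.1 1), one_mul_single, ← MaximalSubgroup.coe_mul,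
    mul_inv_cancel, MaximalSubgroup.coe_one, single_mul_primitive_of_le le_rfl,
    primitive_mul_self]

theorem map_prodMap_primitiveDiagonal {m : Bidual (EllOne (MaximalSubgroup e))}
    (hm : m (augmentation (MaximalSubgroup e)) = 1) :
    Bidual.map (prodMap (EllOne S)) (Bidual.map (primitiveDiagonal e) m) =
      Bidual.incl _ (primitive e) := by
  rw [Bidual.map_comp, prodMap_comp_primitiveDiagonal]
  refine Bidual.ext fun f => ?_
  have : dualMap ((augmentation (MaximalSubgroup e)).smulRight (primitive e)) f =
      f (primitive e) • augmentation (MaximalSubgroup e) := by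
    ext x
    simp [mul_comm]
  rw [Bidual.map_apply, this, map_smul, hm, smul_eq_mul, mul_one]
  rfl

theorem bidualLeftAct_primitiveDiagonal_of_not_le {s : S} (hs : ¬ e ≤ dom s)
    (m : Bidual (EllOne (MaximalSubgroup e))) :
    bidualLeftAct (single s 1) (Bidual.map (primitiveDiagonal e) m) = 0 := by
  rw [bidualLeftAct_map, leftAct_comp_primitiveDiagonal_of_not_le hs, Bidual.map_zero_left]

theorem bidualLeftAct_primitiveDiagonal_eq {m : Bidual (EllOne (MaximalSubgroup e))}
    (hm : ∀ g, Bidual.map (mulLeft (single g 1)) m = m) (s : S) :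
    bidualLeftAct (single s 1) (Bidual.map (primitiveDiagonal e) m) =
      bidualRightAct (single s 1) (Bidual.map (primitiveDiagonal e) m) := by
  rw [bidualRightAct_map]
  by_cases hs : e ≤ dom s
  · rw [bidualLeftAct_map, leftAct_comp_primitiveDiagonal hs, ← Bidual.map_comp, hm]
  · rw [bidualLeftAct_primitiveDiagonal_of_not_le hs,
      rightAct_comp_primitiveDiagonal_of_not_le hs, Bidual.map_zero_left]

theorem norm_bidualLeftAct_primitiveDiagonal_le {N : ℕ}
    (hN : ∀ e : Idempotents S, #(Iic e) ≤ N) {m : Bidual (EllOne (MaximalSubgroup e))}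
    (hm : ‖m‖ ≤ 1) (s : S) :
    ‖bidualLeftAct (single s 1) (Bidual.map (primitiveDiagonal e) m)‖ ≤
      (N + 1 : ℝ) ^ N * (N + 1 : ℝ) ^ N := by
  have h1 : ‖leftAct (single s 1)‖ ≤ 1 := by
    simpa [norm_single] using norm_leftAct_le (single s 1)
  have h2 := norm_primitive_le hN e
  calc _ ≤ ‖leftAct (single s 1)‖ * ‖Bidual.map (primitiveDiagonal e) m‖ := Bidual.norm_map_le _ _
    _ ≤ 1 * (‖primitiveDiagonal e‖ * ‖m‖) := by
      gcongr
      exact Bidual.norm_map_le _ _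
    _ ≤ 1 * (‖primitive e‖ * ‖primitive e‖ * 1) := by
      gcongr
      exact norm_primitiveDiagonal_le e
    _ ≤ _ := by
      rw [one_mul, mul_one]
      gcongr

theorem isBiflat_of_isAmenableGroup {N : ℕ} (hN : ∀ e : Idempotents S, #(Iic e) ≤ N)
    (h : ∀ e : Idempotents S, IsAmenableGroup (MaximalSubgroup e)) : IsBiflat (EllOne S) := by
  choose m hnorm hone hinv using fun e => exists_bidual_of_isAmenableGroup (h e)
  refine isBiflat_of_family (fun e => Bidual.map (primitiveDiagonal e) (m e))
    -- At most `N` summands occur, and each is bounded by `‖u_e‖²`, hence by the square of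
    -- `(N+1)^N`.
    (fun s => Iic (dom s)) (N * ((N + 1 : ℝ) ^ N * (N + 1 : ℝ) ^ N)) (fun s => ?_) (fun s t => ?_)
    (fun s e he => bidualLeftAct_primitiveDiagonal_of_not_le (fun hle => he (mem_Iic.2 hle)) _)
    (fun s e => bidualLeftAct_primitiveDiagonal_eq (hinv e) s) fun s => ?_
  · refine (norm_sum_le _ _).trans ((sum_le_sum fun e _ =>
      norm_bidualLeftAct_primitiveDiagonal_le hN (hnorm e) s).trans ?_)
    rw [sum_const, nsmul_eq_mul]
    gcongr
    exact hN _
  · rw [dom_mul]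
    exact ⟨Iic_subset_Iic.2 (Idempotents.mul_le_left _ _),
      Iic_subset_Iic.2 (Idempotents.mul_le_right _ _)⟩
  · have h1 : ∀ e, Bidual.map (mulLeft (single s 1)) (Bidual.map (prodMap (EllOne S))
        (Bidual.map (primitiveDiagonal e) (m e))) =
        Bidual.incl _ (mulLeft (single s 1) (primitive e)) := fun e => by
      rw [map_prodMap_primitiveDiagonal (hone e), Bidual.map_incl]
    -- The pieces reassemble: `δ_s ∑_{e ≤ ss*} u_e = δ_s δ_{ss*} = δ_s`.
    rw [sum_congr rfl fun e _ => h1 e, ← map_sum, ← map_sum, sum_primitive,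
      ContinuousLinearMap.mul_apply', one_mul_single, self_mul_dom]

end Biflat

/-! ### A mean for every character of `ℓ¹(S)` -/

section CharacterMean

open EllOne Finset

variable {S : Type*} [Semigroup S] [IsCliffordSemigroup S]
  [LocallyFiniteOrderBot (Idempotents S)]

/-- The support of a character of `ℓ¹(S)` is the filter of some idempotent. -/
theorem exists_support_idempotent (φ : WeakDual.characterSpace ℂ (EllOne S)) :
    ∃ e : Idempotents S, charDual φ (single e.1 1) = 1 ∧
      ∀ s, ¬ e ≤ dom s → charDual φ (single s 1) = 0 := by
  classical
  have hmul : ∀ s t : S, charDual φ (single (s * t) 1) =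
      charDual φ (single s 1) * charDual φ (single t 1) := fun s t => by
    rw [← one_mul_single, charDual_mul]
  have hidem : ∀ s, charDual φ (single s 1) ≠ 0 → charDual φ (single (dom s).1 1) = 1 := by
    intro s hs
    have := hmul s (dom s).1
    rw [self_mul_dom] at this
    exact (mul_right_eq_self₀.1 this.symm).resolve_right hs
  obtain ⟨s, hs⟩ : ∃ s, charDual φ (single s 1) ≠ 0 := by
    by_contra! h0
    obtain ⟨b, hb⟩ := exists_char_eq_one φ
    have : charDual φ = 0 := hom_ext_one fun s => h0 s
    rw [this] at hb
    exact zero_ne_one hb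
  -- A minimal idempotent of the support is its least one: if `φ(δ_t) ≠ 0`, then `φ` is 1 at `e ·
  -- tt*` as well, and minimality forces `e ≤ tt*`.
  obtain ⟨e, he, hmin⟩ := WellFounded.has_min (wellFounded_lt (α := Idempotents S))
    {e | charDual φ (single e.1 1) = 1} ⟨dom s, hidem s hs⟩
  refine ⟨e, he, fun t ht => ?_⟩
  by_contra h0
  have h1 : charDual φ (single (e * dom t).1 1) = 1 := by
    rw [Idempotents.coe_mul, hmul, hidem t h0, he, one_mul]
  refine ht ?_
  have h2 : e * dom t = e := by
    by_contra hne
    exact hmin _ h1 (lt_of_le_of_ne (Idempotents.mul_le_left e (dom t)) hne)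
  exact Idempotents.le_def.2 h2

/-- The mean is the image of an invariant functional on `G_e` under `δ_g ↦ χ(g⁻¹) u_e δ_g`, where
`e` is the least idempotent of the support and `χ` the restriction of `φ` to `S`. The twist makes
translation by `k ∈ G_e` act as `χ(k)`; the factor `u_e` kills every `s` not above `e`, where `χ`
vanishes too. -/
theorem exists_mean_of_isAmenableGroup
    (h : ∀ e : Idempotents S, IsAmenableGroup (MaximalSubgroup e))
    (φ : WeakDual.characterSpace ℂ (EllOne S)) :
    ∃ m : Bidual (EllOne S), (∀ a, Bidual.map (mulLeft a) m = charDual φ a • m) ∧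
      m (charDual φ) = 1 := by
  obtain ⟨e, he, hsupp⟩ := exists_support_idempotent φ
  obtain ⟨μ, -, hone, hinv⟩ := exists_bidual_of_isAmenableGroup (h e)
  set χ : S → ℂ := fun s => charDual φ (single s 1) with hχ
  have hmul : ∀ s t : S, χ (s * t) = χ s * χ t := fun s t => by
    simp only [hχ]
    rw [← one_mul_single, charDual_mul]
  have hinv1 : ∀ g : MaximalSubgroup e, χ g.1 * χ (g⁻¹).1 = 1 := fun g => by
    rw [← hmul, ← MaximalSubgroup.coe_mul, mul_inv_cancel]
    exact he
  let D : EllOne (MaximalSubgroup e) →L[ℂ] EllOne S :=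
    extend (fun g => χ (g⁻¹).1 • single g.1 1) ‖charDual φ‖ fun g => by
      rw [norm_smul, norm_single, norm_one, mul_one]
      refine ((charDual φ).le_opNorm _).trans ?_
      rw [norm_single, norm_one, mul_one]
  have hD : ∀ g, D (single g 1) = χ (g⁻¹).1 • single g.1 1 := fun g => extend_single _ _ _ g
  -- Every `u_f` with `f < e` contains the factor `δ_f`, on which `φ` vanishes.
  have hu : charDual φ (primitive e) = 1 := by
    rw [primitive_eq, map_sub, he, map_sum, sum_eq_zero, sub_zero]
    intro f hf
    rw [← single_mul_primitive_of_le le_rfl, charDual_mul, hsupp, zero_mul]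
    rw [dom_idem]
    exact not_le_of_gt (mem_Iio.1 hf)
  let T : EllOne (MaximalSubgroup e) →L[ℂ] EllOne S := (mulLeft (primitive e)).comp D
  have hT : ∀ s, Bidual.map (mulLeft (single s 1)) (Bidual.map T μ) = χ s • Bidual.map T μ := by
    intro s
    by_cases hs : e ≤ dom s
    · have key : (mulLeft (single s 1)).comp T =
          χ s • T.comp (mulLeft (single (MaximalSubgroup.ofLE s hs) 1)) := by
        refine hom_ext_one fun g => ?_
        set k := MaximalSubgroup.ofLE s hs with hk
        have hks : χ k.1 = χ s := by
          change χ (e.1 * s) = χ s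
          rw [hmul, show χ e.1 = 1 from he, one_mul]
        have h1 : single s 1 * (primitive e * single g.1 1) =
            primitive e * single (k * g).1 1 := by
          rw [← mul_assoc, single_mul_primitive_eq hs, single_mul_primitive_comm, mul_assoc,
            one_mul_single]
          rfl
        -- The scalar `χ(s) = χ(k)` cancels the `χ(k⁻¹)` produced by passing from `g` to `kg`.
        have h2 : χ s * χ ((k * g)⁻¹).1 = χ (g⁻¹).1 := by
          rw [mul_inv_rev, MaximalSubgroup.coe_mul, hmul, mul_comm (χ s), mul_assoc, ← hks,
            mul_comm (χ (k⁻¹).1), hinv1, mul_one]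
        simp only [T, ContinuousLinearMap.comp_apply, ContinuousLinearMap.mul_apply', hD,
          _root_.smul_apply, one_mul_single, mul_smul_comm, h1, smul_smul, h2]
      rw [Bidual.map_comp, key, Bidual.map_smul_left, ← Bidual.map_comp, hinv]
    · have key : (mulLeft (single s 1)).comp T = 0 := by
        change (mulLeft (single s 1)).comp ((mulLeft (primitive e)).comp D) = 0
        rw [← ContinuousLinearMap.comp_assoc, mulLeft_comp, single_mul_primitive_of_not_le hs,
          mulLeft, map_zero, ContinuousLinearMap.zero_comp]
      rw [Bidual.map_comp, key, Bidual.map_zero_left, show χ s = 0 from hsupp s hs, zero_smul]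
  refine ⟨Bidual.map T μ, fun a => ?_, ?_⟩
  -- Both sides are bounded and linear in `a`, so the identity extends from point masses.
  · exact DFunLike.congr_fun (hom_ext_one
      (T := Bidual.mapApply (ContinuousLinearMap.mul ℂ (EllOne S)) (Bidual.map T μ))
      (U := (charDual φ).smulRight (Bidual.map T μ)) hT) a
  · have : dualMap T (charDual φ) = augmentation (MaximalSubgroup e) := by
      refine hom_ext_one fun g => ?_
      rw [dualMap_apply, augmentation, extend_single]
      change charDual φ (primitive e * D (single g 1)) = 1
      rw [charDual_mul, hu, hD, map_smul, one_mul, smul_eq_mul, mul_comm]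
      exact hinv1 g
    rw [Bidual.map_apply, this, hone]

end CharacterMean

end PhiBiflat

theorem mainTheorem4 (S : Type*) [Semigroup S] [IsCliffordSemigroup S]
    (hE : IdempotentsUniformlyLocallyFinite S) :
    List.TFAE [
      ∀ φ : WeakDual.characterSpace ℂ (EllOne S),
        IsLeftBiflat (Bidual (EllOne S)) (bidualCharacter φ),
      ∀ φ : WeakDual.characterSpace ℂ (EllOne S), IsLeftBiflat (EllOne S) φ,
      ∀ e : Idempotents S, IsAmenableGroup (MaximalSubgroup e),
      IsBiflat (EllOne S)] := by
  obtain ⟨_, N, hN⟩ := exists_locallyFiniteOrderBot hE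
  tfae_have 1 → 3 := fun h e => isAmenableGroup_of_hasLocalMean e
    (hasLocalMean_of_isLeftBiflat_bidual (h _) _)
  tfae_have 2 → 3 := fun h e => isAmenableGroup_of_hasLocalMean e
    (hasLocalMean_of_isLeftBiflat (h _) _)
  tfae_have 4 → 3 := fun h e => isAmenableGroup_of_hasLocalMean e
    (hasLocalMean_of_isBiflat h _ _)
  tfae_have 3 → 1 := fun h φ => by
    obtain ⟨m, hm, h1⟩ := exists_mean_of_isAmenableGroup h φ
    exact isLeftBiflat_bidual_of_mean φ m hm h1
  tfae_have 3 → 2 := fun h φ => by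
    obtain ⟨m, hm, h1⟩ := exists_mean_of_isAmenableGroup h φ
    exact isLeftBiflat_of_mean φ m hm h1
  tfae_have 3 → 4 := isBiflat_of_isAmenableGroup hN
  tfae_finish
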